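/- All graphs are finite and simple. Let $G$ be a graph and let $\varphi$ be a colouring of its edges. Two distinct edges are adjacent if they share an endvertex, and $N(e)$ denotes the set of edges adjacent to $e$. The colouring $\varphi$ is proper if adjacent edges receive distinct colours. An edge $e$ is rich if the edges in $N(e)$ receive pairwise distinct colours (in a cubic graph: four distinct colours), and poor if the edges in $N(e)$ are coloured with exactly two distinct colours. A normal edge-colouring of $G$ is a proper edge-colouring in which every edge is rich or poor. The graph $G$ is normal $k$-edge-choosable if for every assignment $L$ of lists of colours to its edges with $|L(e)| \ge k$ for every $e \in E(G)$, there is a normal edge-colouring $\varphi$ of $G$ with $\varphi(e) \in L(e)$ for every $e \in E(G)$. The list normal chromatic index $\chi'_{\ell,n}(G)$ is the least $k$ such that $G$ is normal $k$-edge-choosable. **Corollary.** For every subcubic graph $G$ (that is, every graph of maximum degree at most $3$), $$\chi'_{\ell,n}(G) \le 10.$$ -/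

import Mathlib

universe u w

namespace SimpleGraph

variable {V : Type u} (G : SimpleGraph V)

/-- The edge-neighbourhood of an edge `e`: the edges adjacent to `e`, that is, the edges
different from `e` that share an endvertex with `e`. -/
def edgeNeighborhood (e : G.edgeSet) : Set G.edgeSet :=
  G.lineGraph.neighborSet e

variable {C : Type w}

/-- A proper edge-colouring: adjacent edges receive distinct colours. -/
def IsProperEdgeColoring (φ : G.edgeSet → C) : Prop :=
  ∀ e f : G.edgeSet, f ∈ G.edgeNeighborhood e → φ e ≠ φ f

/-- An edge is rich if the edges adjacent to it receive pairwise distinct colours. In a cubic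
graph an edge has four adjacent edges, so this says that they are coloured with four distinct
colours. -/
def IsRichEdge (φ : G.edgeSet → C) (e : G.edgeSet) : Prop :=
  Set.InjOn φ (G.edgeNeighborhood e)

/-- An edge is poor if the edges adjacent to it are coloured with exactly two distinct colours. -/
def IsPoorEdge (φ : G.edgeSet → C) (e : G.edgeSet) : Prop :=
  (φ '' G.edgeNeighborhood e).ncard = 2

/-- A normal edge-colouring: a proper edge-colouring in which every edge is rich or poor. -/
def IsNormalEdgeColoring (φ : G.edgeSet → C) : Prop :=
  G.IsProperEdgeColoring φ ∧ ∀ e : G.edgeSet, G.IsRichEdge φ e ∨ G.IsPoorEdge φ e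

/-- `G` is normal `L`-edge-colourable: it has a normal edge-colouring in which every edge
receives a colour from its list. -/
def IsNormalListEdgeColorable (L : G.edgeSet → Finset C) : Prop :=
  ∃ φ : G.edgeSet → C, G.IsNormalEdgeColoring φ ∧ ∀ e, φ e ∈ L e

/-- `G` is normal `k`-edge-choosable: it is normal `L`-edge-colourable for every assignment of
lists of at least `k` colours to its edges, the colours coming from an arbitrary type. -/
def IsNormalEdgeChoosable (k : ℕ) : Prop :=
  ∀ (C : Type w) (L : G.edgeSet → Finset C), (∀ e, k ≤ (L e).card) →
    G.IsNormalListEdgeColorable L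

/-- The list normal chromatic index: the least `k` such that `G` is normal `k`-edge-choosable
(`⊤` if there is no such `k`). -/
noncomputable def listNormalChromaticIndex : ℕ∞ :=
  ⨅ (k : ℕ) (_ : IsNormalEdgeChoosable.{u, w} G k), (k : ℕ∞)

end SimpleGraph

/-!
# The list normal chromatic index of a subcubic graph is at most ten

A colouring of the edges in which edges at distance at most one (`SimpleGraph.StrongAdj`) receive
distinct colours is proper, and all edges are rich in it. So it suffices to find such a strong
edge-colouring of a subcubic graph from any lists of ten colours
(`SimpleGraph.exists_strongEdgeColoring`), and this can be done for each component separately.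

An edge of a subcubic graph is close to at most twelve others. If the edges are coloured towards a
set `S` of vertices, farthest first, then an edge that does not meet `S` still has the three edges
at a vertex closer to `S` uncoloured, and hence one of its ten colours is left. This is the greedy
part of the core lemma `SimpleGraph.isStrongColorableAt_of_core`. If the component has a vertex of
degree at most two, this vertex serves as `S`. Otherwise `S` consists of the vertices of a short
configuration, and the edges at `S`, the core, are coloured last. Each of them has a list of
remaining colours whose length can be bounded by counting, and the core is coloured from these
lists by the Alon–Tarsi criterion (`exists_listColoring_of_orientCount_ne_zero`): the graph
polynomial of the conflict graph of the core has a nonzero coefficient at a monomial whose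
exponents are smaller than the lengths of the lists.

The configurations are triangles, dominoes (two 4-cycles sharing an edge), other 4-cycles, and at
last a shortest cycle of length `g ≥ 5`. In the last case the core consists of the edges of the
cycle and the pendant edges, and the cycle being shortest determines the conflict graph, except
that for `g = 5` and `g = 6` some pairs of pendant edges may or may not be in conflict. The required
coefficient is computed by expanding the polynomial factor by factor (`expandEdges`). For large `g`
the conflict graph is a ladder with its ends joined. After its outer part has been expanded, a
linear combination of six coefficients of a shorter ladder remains, and one more step of the ladder
only changes the sign of this combination (`evalSum_ladder_ne_zero`), so that an induction on `g`
applies.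
-/

/-! ### The coefficient of a graph polynomial and list colourings -/

open Classical in
/-- Signed number of orientations of the (multi)graph on `ℕ` with edge list `E` in which the vertex
`i` is chosen as the tail of exactly `s i` edges; choosing the second entry of a pair costs a
sign. It is the coefficient of `∏ xᵢ ^ sᵢ` in `∏ (xᵤ - xᵥ)`, the product being over the pairs
`(u, v)` of the list. -/
noncomputable def orientCount : List (ℕ × ℕ) → (ℕ → ℕ) → ℤ
  | [], s => if s = 0 then 1 else 0
  | e :: E, s =>
    (if s e.1 = 0 then 0 else orientCount E (Function.update s e.1 (s e.1 - 1))) -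
      (if s e.2 = 0 then 0 else orientCount E (Function.update s e.2 (s e.2 - 1)))

theorem coeff_graphPolynomial (E : List (ℕ × ℕ)) (s : ℕ →₀ ℕ) :
    MvPolynomial.coeff s (E.map fun e => (MvPolynomial.X e.1 - MvPolynomial.X e.2 :
      MvPolynomial ℕ ℤ)).prod = orientCount E s := by
  induction E generalizing s with
  | nil =>
    simp only [List.map_nil, List.prod_nil, orientCount, MvPolynomial.coeff_one]
    by_cases h : s = 0
    · simp [h]
    · have h' : (s : ℕ → ℕ) ≠ 0 := fun h0 => h (DFunLike.coe_injective h0)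
      simp [h', Ne.symm h]
  | cons e E ih =>
    have key : ∀ u : ℕ, ((s - Finsupp.single u 1 : ℕ →₀ ℕ) : ℕ → ℕ) =
        Function.update s u (s u - 1) := by
      intro u
      funext x
      by_cases hx : x = u
      · subst hx; simp
      · simp [hx]
    simp only [List.map_cons, List.prod_cons, sub_mul, MvPolynomial.coeff_sub, orientCount,
      MvPolynomial.coeff_X_mul', ih, key, Finsupp.mem_support_iff, ite_not]

theorem graphPolynomial_isHomogeneous (E : List (ℕ × ℕ)) :
    ((E.map fun e => (MvPolynomial.X e.1 - MvPolynomial.X e.2 :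
      MvPolynomial ℕ ℤ)).prod).IsHomogeneous E.length := by
  induction E with
  | nil => simpa using MvPolynomial.isHomogeneous_one ℕ ℤ
  | cons e E ih =>
    simp only [List.map_cons, List.prod_cons, List.length_cons]
    rw [add_comm]
    exact ((MvPolynomial.isHomogeneous_X ℤ e.1).sub (MvPolynomial.isHomogeneous_X ℤ e.2)).mul ih

/-- A variable with positive exponent has to occur in the product. -/
theorem orientCount_eq_zero {E : List (ℕ × ℕ)} {s : ℕ → ℕ} {x : ℕ} (hx : s x ≠ 0)
    (hE : ∀ e ∈ E, e.1 ≠ x ∧ e.2 ≠ x) : orientCount E s = 0 := by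
  induction E generalizing s with
  | nil =>
    have : s ≠ 0 := fun h => hx (by simp [h])
    simp [orientCount, this]
  | cons e E ih =>
    have he := hE e (by simp)
    have hE' : ∀ e ∈ E, e.1 ≠ x ∧ e.2 ≠ x := fun f hf => hE f (by simp [hf])
    have h1 := ih (s := Function.update s e.1 (s e.1 - 1))
      (by simpa [Function.update_of_ne he.1.symm] using hx) hE'
    have h2 := ih (s := Function.update s e.2 (s e.2 - 1))
      (by simpa [Function.update_of_ne he.2.symm] using hx) hE'
    simp [orientCount, h1, h2]

/-- The Alon–Tarsi criterion, a case of the combinatorial Nullstellensatz: if the graph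
polynomial has a nonzero coefficient at `t`, then the graph can be coloured from any lists of more
than `t i` colours. -/
theorem exists_listColoring_of_orientCount_ne_zero (E : List (ℕ × ℕ)) (t : ℕ → ℕ)
    (h : orientCount E t ≠ 0) {C : Type w} (l : ℕ → Finset C) (hl : ∀ i, t i < (l i).card) :
    ∃ ψ : ℕ → C, (∀ i, ψ i ∈ l i) ∧ ∀ e ∈ E, ψ e.1 ≠ ψ e.2 := by
  classical
  have hfin : (Function.support t).Finite := by
    refine Set.Finite.subset
      ((E.map Prod.fst ++ E.map Prod.snd).toFinset.finite_toSet) fun x hx => ?_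
    by_contra hcon
    refine h (orientCount_eq_zero (x := x) hx fun e he => ⟨?_, ?_⟩) <;>
    · rintro rfl
      apply hcon
      simp only [List.coe_toFinset, List.mem_append, List.mem_map, Set.mem_ofPred_eq]
      first
      | exact Or.inl ⟨e, he, rfl⟩
      | exact Or.inr ⟨e, he, rfl⟩
  obtain ⟨t', rfl⟩ : ∃ t' : ℕ →₀ ℕ, (t' : ℕ → ℕ) = t :=
    ⟨Finsupp.ofSupportFinite t hfin, rfl⟩
  rw [← coeff_graphPolynomial] at h
  obtain ⟨f, hf⟩ := Set.countable_iff_exists_injOn.1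
    (Set.countable_iUnion fun i => (l i).countable_toSet)
  have hfi : ∀ i, Set.InjOn (fun c => (f c : ℤ)) (l i) := fun i a ha b hb hab =>
    hf (Set.mem_iUnion.2 ⟨i, ha⟩) (Set.mem_iUnion.2 ⟨i, hb⟩) (Nat.cast_injective hab)
  have hhom := graphPolynomial_isHomogeneous E
  have hdeg : t'.degree = E.length := by
    have := hhom h
    rwa [Finsupp.degree_eq_weight_one]
  -- The Nullstellensatz is applied in the finitely many variables that occur.
  obtain ⟨V, P, hP⟩ := MvPolynomial.exists_finset_rename
    (E.map fun e => (MvPolynomial.X e.1 - MvPolynomial.X e.2 : MvPolynomial ℕ ℤ)).prod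
  rw [hP] at h hhom
  obtain ⟨t₁, rfl, ht₁⟩ := MvPolynomial.coeff_rename_ne_zero _ _ _ h
  have htd := ((MvPolynomial.IsHomogeneous.rename_isHomogeneous_iff Subtype.val_injective).1
    hhom).totalDegree (fun h0 => ht₁ (by simp [h0]))
  have hval : ∀ i : {x // x ∈ V}, t₁.mapDomain Subtype.val (i : ℕ) = t₁ i := fun i =>
    Finsupp.mapDomain_apply Subtype.val_injective _ _
  obtain ⟨s, hs, hev⟩ := MvPolynomial.combinatorial_nullstellensatz_exists_eval_nonzero P t₁ ht₁
    (by rw [htd, ← hdeg, Finsupp.degree_mapDomain])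
    (fun i => (l i).image fun c => (f c : ℤ))
    (fun i => by rw [Finset.card_image_of_injOn (hfi i), ← hval]; exact hl i)
  have hs' : ∀ i : ℕ, ∃ c ∈ l i, ∀ hi : i ∈ V, (f c : ℤ) = s ⟨i, hi⟩ := by
    intro i
    by_cases hi : i ∈ V
    · obtain ⟨c, hc, hcs⟩ := Finset.mem_image.1 (hs ⟨i, hi⟩)
      exact ⟨c, hc, fun _ => hcs⟩
    · obtain ⟨c, hc⟩ := Finset.card_pos.1 ((Nat.zero_le _).trans_lt (hl i))
      exact ⟨c, hc, fun h => absurd h hi⟩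
  choose ψ hψ hψs using hs'
  refine ⟨ψ, hψ, fun e he hcon => hev ?_⟩
  have : s = (fun i => (f (ψ i) : ℤ)) ∘ Subtype.val := by
    funext i
    exact (hψs i i.2).symm
  rw [this, ← MvPolynomial.eval_rename, ← hP, map_list_prod, List.prod_eq_zero_iff]
  simp only [List.map_map, List.mem_map, Function.comp_apply]
  exact ⟨e, he, by simp [hcon]⟩

/-! ### Computing coefficients of graph polynomials -/

/-- The `x`-th hexadecimal digit of `k`. A natural number encodes the vector of its digits. -/
def hexDigit (k x : ℕ) : ℕ := k / 16 ^ x % 16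

theorem hexDigit_sub {k u : ℕ} (h : hexDigit k u ≠ 0) :
    hexDigit (k - 16 ^ u) = Function.update (hexDigit k) u (hexDigit k u - 1) := by
  funext x
  unfold hexDigit at *
  obtain ⟨q, a, ha, rfl⟩ : ∃ q a, a < 16 ^ u ∧ k = a + 16 ^ u * q :=
    ⟨k / 16 ^ u, k % 16 ^ u, Nat.mod_lt _ (by positivity), (Nat.mod_add_div _ _).symm⟩
  have hp : ∀ n, 0 < 16 ^ n := fun n => by positivity
  have hdiv : ∀ q, (a + 16 ^ u * q) / 16 ^ u = q := fun q => by
    rw [Nat.add_mul_div_left _ _ (hp u), Nat.div_eq_of_lt ha, zero_add]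
  rw [hdiv] at h
  obtain ⟨q, rfl⟩ : ∃ r, q = r + 1 := ⟨q - 1, by rcases q with _ | q <;> simp_all⟩
  have hsub : a + 16 ^ u * (q + 1) - 16 ^ u = a + 16 ^ u * q := by
    rw [mul_add, mul_one]; omega
  rw [hsub]
  rcases lt_trichotomy x u with hx | rfl | hx
  · rw [Function.update_of_ne hx.ne]
    obtain ⟨j, rfl⟩ : ∃ j, u = x + 1 + j := ⟨u - (x + 1), by omega⟩
    have e : ∀ q, a + 16 ^ (x + 1 + j) * q = a + 16 ^ x * (16 * (16 ^ j * q)) := fun q => by ring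
    rw [e, e, Nat.add_mul_div_left _ _ (hp x), Nat.add_mul_div_left _ _ (hp x)]
    omega
  · rw [Function.update_self, hdiv, hdiv]
    omega
  · rw [Function.update_of_ne hx.ne']
    obtain ⟨j, rfl⟩ : ∃ j, x = u + 1 + j := ⟨x - (u + 1), by omega⟩
    rw [show 16 ^ (u + 1 + j) = 16 ^ u * (16 * 16 ^ j) by ring]
    simp only [← Nat.div_div_eq_div_mul, hdiv]
    congr 2
    omega

/-- The order embedding of `ℕ` that leaves a gap of length `2 * d` in front of `4`. -/
def gapEmb (d x : ℕ) : ℕ := if x < 4 then x else x + 2 * d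

/-- The exponent vector read off from the digits of `k`, with `d` copies of the exponents `3, 4`
inserted at position `4`. -/
def gapExp (d k x : ℕ) : ℕ :=
  if x < 4 then hexDigit k x
  else if x < 4 + 2 * d then (if x % 2 = 0 then 3 else 4) else hexDigit k (x - 2 * d)

theorem gapEmb_injective (d : ℕ) : Function.Injective (gapEmb d) := by
  intro x y h
  unfold gapEmb at h
  split_ifs at h <;> omega

theorem gapExp_gapEmb (d k u : ℕ) : gapExp d k (gapEmb d u) = hexDigit k u := by
  unfold gapExp gapEmb
  by_cases h : u < 4
  · simp [h]
  · simp [h, show ¬ u + 2 * d < 4 by omega]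

theorem gapExp_sub (d : ℕ) {k u : ℕ} (h : hexDigit k u ≠ 0) :
    gapExp d (k - 16 ^ u) =
      Function.update (gapExp d k) (gapEmb d u) (gapExp d k (gapEmb d u) - 1) := by
  funext x
  by_cases hx : x = gapEmb d u
  · subst hx
    rw [Function.update_self, gapExp_gapEmb, gapExp_gapEmb, hexDigit_sub h, Function.update_self]
  · rw [Function.update_of_ne hx]
    unfold gapExp
    rw [hexDigit_sub h]
    unfold gapEmb at hx
    split_ifs with h1 h2 h3
    · rw [Function.update_of_ne]; split_ifs at hx <;> omega
    · rfl
    · rfl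
    · rw [Function.update_of_ne]; split_ifs at hx <;> omega

theorem gapExp_zero (k : ℕ) : gapExp 0 k = hexDigit k := by
  funext x
  unfold gapExp
  split_ifs <;> rfl

theorem gapEmb_zero : gapEmb 0 = id := by
  funext x
  simp [gapEmb]

/-- Sum of two formal sums, that is, lists of encoded exponent vectors with coefficients, both
sorted by the code; the fuel `n` bounds the total length. -/
def mergeSums : ℕ → List (ℕ × ℤ) → List (ℕ × ℤ) → List (ℕ × ℤ)
  | 0, a, b => a ++ b
  | _ + 1, [], b => b
  | _ + 1, p :: a, [] => p :: a
  | n + 1, p :: a, q :: b =>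
    bif Nat.blt p.1 q.1 then p :: mergeSums n a (q :: b)
    else bif Nat.blt q.1 p.1 then q :: mergeSums n (p :: a) b
    else bif p.2 + q.2 == 0 then mergeSums n a b
    else (p.1, p.2 + q.2) :: mergeSums n a b

/-- Lower the exponent of `u` by one in every term in which it is positive; the other terms are
dropped, and the coefficients are multiplied by `c`. -/
def lowerExp (c : ℤ) (u : ℕ) (st : List (ℕ × ℤ)) : List (ℕ × ℤ) :=
  (st.filter fun p => !(hexDigit p.1 u == 0)).map fun p => (p.1 - 16 ^ u, c * p.2)

/-- Drop the terms in which the exponent of `x` is positive, if `x` is marked by `fin` and does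
not occur in `E`: their coefficients vanish, as `x` occurs in no remaining factor. This keeps the
formal sums short. -/
def dropUnused (fin : ℕ → Bool) (E : List (ℕ × ℕ)) (x : ℕ) (st : List (ℕ × ℤ)) :
    List (ℕ × ℤ) :=
  bif fin x && E.all (fun e => !(e.1 == x) && !(e.2 == x)) then
    st.filter fun p => hexDigit p.1 x == 0
  else st

/-- Expand the factors of the graph polynomial of `E` one by one, starting from the formal sum
`st` of exponent vectors that remain to be matched. -/
def expandEdges (fin : ℕ → Bool) : List (ℕ × ℕ) → List (ℕ × ℤ) → List (ℕ × ℤ)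
  | [], st => st
  | e :: E, st =>
    expandEdges fin E (dropUnused fin E e.1 (dropUnused fin E e.2
      (mergeSums (2 * st.length) (lowerExp 1 e.1 st) (lowerExp (-1) e.2 st))))

/-- The linear extension of a function of codes to formal sums. -/
def evalSum (f : ℕ → ℤ) (st : List (ℕ × ℤ)) : ℤ := (st.map fun p => p.2 * f p.1).sum

theorem evalSum_mergeSums (f : ℕ → ℤ) (n : ℕ) (a b : List (ℕ × ℤ)) :
    evalSum f (mergeSums n a b) = evalSum f a + evalSum f b := by
  induction n generalizing a b with
  | zero => simp [mergeSums, evalSum]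
  | succ n ih =>
    rcases a with _ | ⟨p, a⟩
    · simp [mergeSums, evalSum]
    rcases b with _ | ⟨q, b⟩
    · simp [mergeSums, evalSum]
    have hc : ∀ (p : ℕ × ℤ) a, evalSum f (p :: a) = p.2 * f p.1 + evalSum f a := fun p a => by
      simp [evalSum]
    simp only [mergeSums]
    rcases h1 : Nat.blt p.1 q.1
    · rcases h2 : Nat.blt q.1 p.1
      · have hpq : q.1 = p.1 := by
          have h1' : ¬ p.1 < q.1 := by
            rw [← Nat.blt_eq]; simp [h1]
          have h2' : ¬ q.1 < p.1 := by
            rw [← Nat.blt_eq]; simp [h2]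
          omega
        rcases h3 : (p.2 + q.2 == 0)
        · simp only [cond_false, hc, ih, hpq]; ring
        · have h3' : p.2 = - q.2 := by
            have : p.2 + q.2 = 0 := by simpa using h3
            omega
          simp only [cond_false, cond_true, hc, ih, hpq, h3']; ring
      · simp only [cond_false, cond_true, hc, ih]; ring
    · simp only [cond_true, hc, ih]; ring

theorem evalSum_filter (f : ℕ → ℤ) (P : ℕ × ℤ → Bool) (st : List (ℕ × ℤ))
    (h : ∀ p, P p = false → f p.1 = 0) : evalSum f (st.filter P) = evalSum f st := by
  induction st with
  | nil => rfl
  | cons p st ih =>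
    rcases hp : P p
    · rw [List.filter_cons_of_neg (by simp [hp]), ih]
      simp [evalSum, h p hp]
    · rw [List.filter_cons_of_pos hp]
      simp only [evalSum, List.map_cons, List.sum_cons] at ih ⊢
      rw [ih]

theorem evalSum_lowerExp (f g : ℕ → ℤ) (c : ℤ) (u : ℕ) (st : List (ℕ × ℤ))
    (h : ∀ k, g k = if hexDigit k u = 0 then 0 else f (k - 16 ^ u)) :
    evalSum f (lowerExp c u st) = c * evalSum g st := by
  unfold lowerExp
  induction st with
  | nil => simp [evalSum]
  | cons p st ih =>
    by_cases hp : hexDigit p.1 u = 0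
    · rw [List.filter_cons_of_neg (by simp [hp]), ih]
      simp [evalSum, h, hp]
    · rw [List.filter_cons_of_pos (by simp [hp])]
      simp only [evalSum, List.map_cons, List.sum_cons] at ih ⊢
      rw [ih, h p.1, if_neg hp]
      ring

/-- Expanding the factors of `E` reduces the coefficients of the graph polynomial of `E ++ T` to
coefficients of that of `T`; the graph `E` is placed by `gapEmb d`, and the marked vertices do not
occur in `T`. -/
theorem evalSum_expandEdges (d : ℕ) (fin : ℕ → Bool) (T : List (ℕ × ℕ))
    (hT : ∀ x, fin x = true → ∀ e ∈ T, e.1 ≠ gapEmb d x ∧ e.2 ≠ gapEmb d x)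
    (E : List (ℕ × ℕ)) (st : List (ℕ × ℤ)) :
    evalSum (fun k => orientCount
      (E.map (fun e => (gapEmb d e.1, gapEmb d e.2)) ++ T) (gapExp d k)) st =
    evalSum (fun k => orientCount T (gapExp d k)) (expandEdges fin E st) := by
  induction E generalizing st with
  | nil => rfl
  | cons e E ih =>
    have hdrop : ∀ (x : ℕ) (st : List (ℕ × ℤ)),
        evalSum (fun k => orientCount (E.map (fun e => (gapEmb d e.1, gapEmb d e.2)) ++ T)
          (gapExp d k)) (dropUnused fin E x st) =
        evalSum (fun k => orientCount (E.map (fun e => (gapEmb d e.1, gapEmb d e.2)) ++ T)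
          (gapExp d k)) st := by
      intro x st
      unfold dropUnused
      rcases hc : fin x && E.all (fun e => !(e.1 == x) && !(e.2 == x))
      · rfl
      · simp only [Bool.and_eq_true, List.all_eq_true, Bool.not_eq_true', beq_eq_false_iff_ne]
          at hc
        refine evalSum_filter _ _ _ fun p hp => ?_
        apply orientCount_eq_zero (x := gapEmb d x)
        · rw [gapExp_gapEmb]
          simpa using hp
        · intro f hf
          rcases List.mem_append.1 hf with hf | hf
          · obtain ⟨f', hf', rfl⟩ := List.mem_map.1 hf
            have := hc.2 f' hf'
            exact ⟨fun h => this.1 (gapEmb_injective d h), fun h => this.2 (gapEmb_injective d h)⟩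
          · exact hT x hc.1 f hf
    rw [expandEdges, ← ih, hdrop, hdrop, evalSum_mergeSums]
    rw [evalSum_lowerExp _ _ _ e.1 st (fun k => rfl), evalSum_lowerExp _ _ _ e.2 st (fun k => rfl)]
    have hsub : ∀ (f g : ℕ → ℤ), 1 * evalSum f st + -1 * evalSum g st =
        evalSum (fun k => f k - g k) st := by
      intro f g
      induction st with
      | nil => simp [evalSum]
      | cons p st ih' =>
        simp only [evalSum, List.map_cons, List.sum_cons] at ih' ⊢
        rw [mul_sub]
        linarith
    rw [hsub]
    congr 1
    funext k
    simp only [List.map_cons, List.cons_append, orientCount, gapExp_gapEmb]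
    congr 1 <;>
    · split_ifs with h
      · rfl
      · rw [gapExp_sub d h, gapExp_gapEmb]

/-- Does the expansion end in a nonzero multiple of the zero exponent vector? -/
def isNonzeroConst : List (ℕ × ℤ) → Bool
  | [(0, c)] => !(c == 0)
  | _ => false

theorem evalSum_of_isNonzeroConst {st : List (ℕ × ℤ)} (h : isNonzeroConst st = true) :
    evalSum (fun k => orientCount [] (gapExp 0 k)) st ≠ 0 := by
  rcases st with _ | ⟨⟨k, c⟩, _ | ⟨q, st⟩⟩
  · simp [isNonzeroConst] at h
  · rcases k with _ | k
    · have h0 : gapExp 0 0 = 0 := by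
        funext x
        simp [gapExp_zero, hexDigit]
      have hc : c ≠ 0 := by simpa [isNonzeroConst] using h
      simpa [evalSum, orientCount, h0] using hc
    · simp [isNonzeroConst] at h
  · rcases k with _ | k <;> simp [isNonzeroConst] at h

theorem evalSum_orientCount_ne_zero {E : List (ℕ × ℕ)} {st : List (ℕ × ℤ)}
    (h : isNonzeroConst (expandEdges (fun _ => true) E st) = true) :
    evalSum (fun k => orientCount E (gapExp 0 k)) st ≠ 0 := by
  have := evalSum_expandEdges 0 (fun _ => true) [] (by simp) E st
  simp only [gapEmb_zero, id, Prod.mk.eta, List.map_id', List.append_nil] at this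
  rw [this]
  exact evalSum_of_isNonzeroConst h

theorem orientCount_hexDigit_ne_zero {E : List (ℕ × ℕ)} {k : ℕ}
    (h : isNonzeroConst (expandEdges (fun _ => true) E [(k, 1)]) = true) :
    orientCount E (hexDigit k) ≠ 0 := by
  simpa [evalSum, gapExp_zero] using evalSum_orientCount_ne_zero h

/-! ### The graph polynomials of ladders and wheels -/

/-- Pairs recording the conflicts of the edges of a path with pendant edges: `2 * j + 1` stands
for the `j`-th edge of the path and `2 * j` for the pendant edge at its end. `ladderBlock j` lists
the conflicts of these two with each other and with earlier edges. -/
def ladderBlock : ℕ → List (ℕ × ℕ)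
  | 0 => [(0, 1)]
  | 1 => [(2, 3), (2, 0), (2, 1), (3, 0), (3, 1)]
  | j + 2 => [(2 * j + 4, 2 * j + 5), (2 * j + 4, 2 * j + 2), (2 * j + 4, 2 * j + 3),
      (2 * j + 5, 2 * j + 2), (2 * j + 5, 2 * j + 3), (2 * j + 5, 2 * j), (2 * j + 5, 2 * j + 1)]

/-- All conflicts of a path with `n` edges and pendant edges, see `ladderBlock`. -/
def ladder : ℕ → List (ℕ × ℕ)
  | 0 => []
  | n + 1 => ladderBlock n ++ ladder n

/-- The additional conflicts that arise when a path with `g` edges is closed to a cycle. -/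
def wheelClosure (g : ℕ) : List (ℕ × ℕ) :=
  [(2 * g - 2, 0), (2 * g - 2, 1), (2 * g - 2, 3), (2 * g - 4, 1), (2 * g - 1, 0), (2 * g - 1, 1),
    (2 * g - 3, 1), (2 * g - 1, 3)]

/-- The conflicts of a long cycle of length `g` with its pendant edges. -/
def wheel (g : ℕ) : List (ℕ × ℕ) := wheelClosure g ++ ladder g

/-- The number with the given hexadecimal digits, the lowest first. -/
def ofHexDigits : List ℕ → ℕ
  | [] => 0
  | a :: l => a + 16 * ofHexDigits l

/-- The exponents used for the wheel with `12` spokes. -/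
def wheelKey : ℕ :=
  ofHexDigits [3, 4, 3, 4, 3, 4, 3, 4, 3, 4, 3, 4, 3, 4, 3, 4, 3, 5, 3, 4, 3, 5, 0, 5]

/-- What remains of the exponents of the wheel when only the innermost part of the ladder is
left: a formal sum of six terms, computed once and used for all long wheels. -/
def wheelRest : List (ℕ × ℤ) :=
  expandEdges (fun x => Nat.ble 8 x)
    (wheelClosure 12 ++ ((List.range 8).map fun j => ladderBlock (11 - j)).flatten) [(wheelKey, 1)]

/-- Insert the exponents `3, 4`, with code `67 = 3 + 16 * 4`, at position `4` into the vector encoded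
by `k`. -/
def insertGap (k : ℕ) : ℕ := k % 16 ^ 4 + 16 ^ 4 * (67 + 256 * (k / 16 ^ 4))

theorem hexDigit_of_lt {k m : ℕ} (hk : k < 16 ^ m) {x : ℕ} (hx : m ≤ x) : hexDigit k x = 0 := by
  unfold hexDigit
  rw [Nat.div_eq_of_lt (hk.trans_le (Nat.pow_le_pow_right (by norm_num) hx))]

theorem hexDigit_add_pow_mul {a m : ℕ} (ha : a < 16 ^ m) (b x : ℕ) :
    hexDigit (a + 16 ^ m * b) x = if x < m then hexDigit a x else hexDigit b (x - m) := by
  unfold hexDigit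
  split_ifs with h
  · obtain ⟨j, rfl⟩ : ∃ j, m = x + 1 + j := ⟨m - (x + 1), by omega⟩
    rw [show a + 16 ^ (x + 1 + j) * b = a + 16 ^ x * (16 * (16 ^ j * b)) by ring,
      Nat.add_mul_div_left _ _ (by positivity)]
    omega
  · obtain ⟨j, rfl⟩ : ∃ j, x = m + j := ⟨x - m, by omega⟩
    rw [pow_add, ← Nat.div_div_eq_div_mul, Nat.add_mul_div_left _ _ (by positivity),
      Nat.div_eq_of_lt ha, zero_add, Nat.add_sub_cancel_left]

theorem hexDigit_insertGap (k x : ℕ) : hexDigit (insertGap k) x =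
    if x < 4 then hexDigit k x else if x = 4 then 3 else if x = 5 then 4
    else hexDigit k (x - 2) := by
  have h1 : ∀ x, hexDigit k x = if x < 4 then hexDigit (k % 16 ^ 4) x
      else hexDigit (k / 16 ^ 4) (x - 4) := fun x => by
    rw [← hexDigit_add_pow_mul (Nat.mod_lt _ (by norm_num)), Nat.mod_add_div]
  unfold insertGap
  rw [hexDigit_add_pow_mul (Nat.mod_lt _ (by norm_num)),
    show (256 : ℕ) = 16 ^ 2 from rfl, hexDigit_add_pow_mul (by norm_num), h1 x, h1 (x - 2)]
  by_cases h4 : x < 4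
  · simp [h4]
  by_cases h5 : x = 4
  · subst h5; simp [hexDigit]
  by_cases h6 : x = 5
  · subst h6; simp [hexDigit]
  simp only [h4, h5, h6, if_false, show ¬ x - 4 < 2 by omega, show ¬ x - 2 < 4 by omega]
  congr 1

theorem gapExp_succ (d k : ℕ) : gapExp (d + 1) k = gapExp d (insertGap k) := by
  funext x
  unfold gapExp
  simp only [hexDigit_insertGap]
  split_ifs <;> first | rfl | omega

/-- One step of the ladder changes only the sign of the sum that remains. -/
theorem expandEdges_ladderBlock : expandEdges (fun x => Nat.ble 8 x) (ladderBlock 4)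
    (wheelRest.map fun p => (insertGap p.1, p.2)) = wheelRest.map fun p => (p.1, -p.2) := by
  decide +kernel

theorem isNonzeroConst_wheelRest :
    isNonzeroConst (expandEdges (fun _ => true) (ladder 4) wheelRest) = true := by
  decide +kernel

theorem ladderBlock_lt {n : ℕ} {e : ℕ × ℕ} (he : e ∈ ladderBlock n) :
    e.1 < 2 * n + 2 ∧ e.2 < 2 * n + 2 := by
  rcases n with _ | _ | n <;>
    simp only [ladderBlock, List.mem_cons, List.not_mem_nil, or_false] at he
  · subst he; simp
  · rcases he with rfl | rfl | rfl | rfl | rfl <;> simp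
  · rcases he with rfl | rfl | rfl | rfl | rfl | rfl | rfl <;> refine ⟨?_, ?_⟩ <;> dsimp <;> omega

theorem ladder_lt {n : ℕ} {e : ℕ × ℕ} (he : e ∈ ladder n) : e.1 < 2 * n ∧ e.2 < 2 * n := by
  induction n with
  | zero => simp [ladder] at he
  | succ n ih =>
    rcases List.mem_append.1 he with he | he
    · have := ladderBlock_lt he; omega
    · have := ih he; omega

/-- The blocks from the fifth one on are translates of each other. -/
theorem ladderBlock_gapEmb (d j : ℕ) : ladderBlock (j + 4 + d) =
    (ladderBlock (j + 4)).map fun e => (gapEmb d e.1, gapEmb d e.2) := by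
  rw [show j + 4 + d = j + d + 2 + 2 by omega, show j + 4 = j + 2 + 2 by omega]
  simp only [ladderBlock, List.map_cons, List.map_nil, gapEmb]
  simp only [show ∀ i, ¬ 2 * (j + 2) + i < 4 from fun i => by omega,
    show ¬ 2 * (j + 2) < 4 by omega, if_false, List.cons.injEq, Prod.mk.injEq, and_true]
  omega

theorem evalSum_neg (f : ℕ → ℤ) (st : List (ℕ × ℤ)) :
    evalSum f (st.map fun p => (p.1, -p.2)) = -evalSum f st := by
  induction st with
  | nil => rfl
  | cons p st ih =>
    simp only [evalSum, List.map_cons, List.sum_cons] at ih ⊢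
    rw [ih]
    ring

/-- The combination of coefficients given by `wheelRest` does not vanish on any longer ladder. -/
theorem evalSum_ladder_ne_zero (d : ℕ) :
    evalSum (fun k => orientCount (ladder (4 + d)) (gapExp d k)) wheelRest ≠ 0 := by
  induction d with
  | zero => exact evalSum_orientCount_ne_zero isNonzeroConst_wheelRest
  | succ d ih =>
    have h := evalSum_expandEdges d (fun x => Nat.ble 8 x) (ladder (4 + d)) (fun x hx e he => by
      have := ladder_lt he
      have hx : 8 ≤ x := by simpa using hx
      unfold gapEmb
      split_ifs <;> omega) (ladderBlock 4) (wheelRest.map fun p => (insertGap p.1, p.2))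
    rw [expandEdges_ladderBlock, ← ladderBlock_gapEmb d 0] at h
    rw [evalSum_neg] at h
    have hmap : ∀ st, evalSum (fun k => orientCount (ladderBlock (0 + 4 + d) ++ ladder (4 + d))
        (gapExp d k)) (st.map fun p => (insertGap p.1, p.2)) = evalSum (fun k => orientCount
          (ladderBlock (0 + 4 + d) ++ ladder (4 + d)) (gapExp (d + 1) k)) st := fun st => by
      simp only [evalSum, List.map_map, Function.comp_def, ← gapExp_succ]
    rw [hmap] at h
    rw [show 0 + 4 + d = 4 + d by omega] at h
    have h2 : ladderBlock (4 + d) ++ ladder (4 + d) = ladder (4 + (d + 1)) := rfl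
    rw [h2] at h
    generalize wheelRest = st at h ih
    rw [h]
    exact neg_ne_zero.2 ih

theorem wheel_eq (d : ℕ) : wheel (12 + d) =
    (wheelClosure 12 ++ ((List.range 8).map fun j => ladderBlock (11 - j)).flatten).map
      (fun e => (gapEmb d e.1, gapEmb d e.2)) ++ ladder (4 + d) := by
  have h1 : wheelClosure (12 + d) =
      (wheelClosure 12).map fun e => (gapEmb d e.1, gapEmb d e.2) := by
    simp only [wheelClosure, List.map_cons, List.map_nil, gapEmb]
    norm_num
    omega
  have h2 : ladder (12 + d) =
      ladderBlock (7 + 4 + d) ++ (ladderBlock (6 + 4 + d) ++ (ladderBlock (5 + 4 + d) ++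
      (ladderBlock (4 + 4 + d) ++ (ladderBlock (3 + 4 + d) ++ (ladderBlock (2 + 4 + d) ++
      (ladderBlock (1 + 4 + d) ++ (ladderBlock (0 + 4 + d) ++ ladder (4 + d)))))))) := by
    rw [show 12 + d = 4 + d + 1 + 1 + 1 + 1 + 1 + 1 + 1 + 1 by omega]
    simp only [ladder, show ∀ i, 4 + d + i = i + 4 + d by intro i; omega, add_assoc, Nat.zero_add]
  rw [wheel, h1, h2]
  simp only [ladderBlock_gapEmb d]
  simp only [List.range, List.range.loop, List.map_cons, List.map_nil, List.flatten_cons,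
    List.flatten_nil, List.map_append, List.append_assoc, List.append_nil]

theorem orientCount_wheel_ne_zero (d : ℕ) :
    orientCount (wheel (12 + d)) (gapExp d wheelKey) ≠ 0 := by
  have h := evalSum_expandEdges d (fun x => Nat.ble 8 x) (ladder (4 + d)) (fun x hx e he => by
      have := ladder_lt he
      have hx : 8 ≤ x := by simpa using hx
      unfold gapEmb
      split_ifs <;> omega) (wheelClosure 12 ++
        ((List.range 8).map fun j => ladderBlock (11 - j)).flatten) [(wheelKey, 1)]
  rw [← wheel_eq] at h
  have h' := evalSum_ladder_ne_zero d
  rw [wheelRest, ← h] at h'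
  simpa [evalSum] using h'

/-- The exponents used for the wheel with `j + 7` spokes. -/
def wheelKeys : List ℕ :=
  [ofHexDigits [3, 4, 3, 4, 3, 4, 3, 5, 3, 4, 3, 5, 0, 5],
    ofHexDigits [3, 4, 3, 4, 3, 4, 3, 4, 3, 5, 3, 4, 3, 5, 0, 5],
    ofHexDigits [3, 4, 3, 4, 3, 4, 3, 4, 3, 4, 3, 5, 3, 4, 3, 5, 0, 5],
    ofHexDigits [3, 4, 3, 4, 3, 4, 3, 4, 3, 4, 3, 4, 3, 5, 3, 4, 3, 5, 0, 5],
    ofHexDigits [3, 4, 3, 4, 3, 4, 3, 4, 3, 4, 3, 4, 3, 4, 3, 5, 3, 4, 3, 5, 0, 5]]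

theorem isNonzeroConst_wheel : ∀ j < 5, isNonzeroConst (expandEdges (fun _ => true) (wheel (j + 7))
    [(wheelKeys.getD j 0, 1)]) = true := by
  decide +kernel

theorem wheelKeys_bound : ∀ j < 5, wheelKeys.getD j 0 < 16 ^ 24 ∧
    ∀ x < 24, hexDigit (wheelKeys.getD j 0) x ≤ if x % 2 = 0 then 3 else 5 := by
  decide +kernel

theorem wheelKey_bound : wheelKey < 16 ^ 24 ∧
    ∀ x < 24, hexDigit wheelKey x ≤ if x % 2 = 0 then 3 else 5 := by
  decide +kernel

/-- The graph polynomial of a long wheel has a monomial in which the exponents of the spokes are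
at most `3` and those of the rim edges at most `5`. -/
theorem exists_orientCount_wheel_ne_zero {g : ℕ} (hg : 7 ≤ g) :
    ∃ t : ℕ → ℕ, orientCount (wheel g) t ≠ 0 ∧ ∀ x, t x ≤ if x % 2 = 0 then 3 else 5 := by
  have key : ∀ k : ℕ, (k < 16 ^ 24 ∧ ∀ x < 24, hexDigit k x ≤ if x % 2 = 0 then 3 else 5) →
      ∀ x, hexDigit k x ≤ if x % 2 = 0 then 3 else 5 := fun k hk x => by
    by_cases hx : x < 24
    · exact hk.2 x hx
    · rw [hexDigit_of_lt hk.1 (not_lt.1 hx)]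
      exact Nat.zero_le _
  by_cases h : g < 12
  · obtain ⟨j, hj, rfl⟩ : ∃ j < 5, g = j + 7 := ⟨g - 7, by omega, by omega⟩
    exact ⟨_, orientCount_hexDigit_ne_zero (isNonzeroConst_wheel j hj),
      key _ (wheelKeys_bound j hj)⟩
  · obtain ⟨d, rfl⟩ : ∃ d, g = 12 + d := ⟨g - 12, by omega⟩
    refine ⟨_, orientCount_wheel_ne_zero d, fun x => ?_⟩
    have h1 := key _ wheelKey_bound x
    have h2 := key _ wheelKey_bound (x - 2 * d)
    have h3 : ¬ x < 4 + 2 * d → (x - 2 * d) % 2 = x % 2 := by omega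
    unfold gapExp
    by_cases hx : x % 2 = 0
    · simp only [hx, if_true] at h1 h3 ⊢
      split_ifs with h4 h5
      · exact h1
      · exact le_rfl
      · simpa [h3 h5] using h2
    · simp only [hx, if_false] at h1 h3 ⊢
      split_ifs with h4 h5
      · exact h1
      · norm_num
      · simpa [h3 h5, hx] using h2

/-! ### The graph polynomials of the small conflict graphs -/

/-- The pairs `(i, j)` with `i < j < n` that are not in `X`. -/
def pairsExcept (n : ℕ) (X : List (ℕ × ℕ)) : List (ℕ × ℕ) :=
  ((List.range n).flatMap fun j => (List.range j).map fun i => (i, j)).filter fun e =>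
    X.all fun f => !(f.1 == e.1 && f.2 == e.2)

/-- The exponents encoded by `k`, increased by one at the first entry of every pair in `Y`. -/
def addFirsts (k : ℕ) (Y : List (ℕ × ℕ)) : ℕ := k + (Y.map fun e => 16 ^ e.1).sum

/-- The complete graph on six vertices. The exponents here and below are smaller than
the lengths of the lists that the counting arguments guarantee. -/
theorem isNonzeroConst_triangle : isNonzeroConst (expandEdges (fun _ => true) (pairsExcept 6 [])
    [(ofHexDigits [2, 5, 1, 4, 0, 3], 1)]) = true := by
  decide +kernel

theorem isNonzeroConst_complete_seven : isNonzeroConst (expandEdges (fun _ => true)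
    (pairsExcept 7 []) [(ofHexDigits [4, 6, 3, 5, 2, 1, 0], 1)]) = true := by
  decide +kernel

theorem isNonzeroConst_domino : isNonzeroConst (expandEdges (fun _ => true)
    (pairsExcept 7 [(5, 6)]) [(ofHexDigits [5, 0, 4, 3, 2, 3, 3], 1)]) = true := by
  decide +kernel

theorem isNonzeroConst_bipartite : isNonzeroConst (expandEdges (fun _ => true)
    (pairsExcept 8 [(0, 4)]) [(ofHexDigits [3, 6, 2, 4, 3, 5, 3, 1], 1)]) = true := by
  decide +kernel

theorem isNonzeroConst_square : isNonzeroConst (expandEdges (fun _ => true)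
    (pairsExcept 8 [(0, 4), (2, 6)]) [(ofHexDigits [3, 4, 3, 2, 3, 5, 3, 3], 1)]) = true := by
  decide +kernel

/-- The conflicts of a pentagon with its pendant edges, including the possible ones. As below, the
order of the pairs keeps the expansion of the graph polynomial short. -/
def pentagonPairs : List (ℕ × ℕ) :=
  [(0, 8), (0, 9), (6, 0), (0, 1), (0, 2), (0, 3), (4, 0), (0, 5), (8, 9), (6, 8), (1, 8),
    (7, 8), (2, 8), (3, 8), (4, 8), (6, 9), (1, 9), (7, 9), (3, 9), (4, 9), (5, 9), (1, 6),
    (6, 7), (2, 6), (4, 6), (5, 6), (1, 7), (1, 2), (1, 3), (1, 5), (2, 7), (3, 7), (4, 7),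
    (5, 7), (2, 3), (2, 4), (2, 5), (3, 4), (3, 5), (4, 5)]

/-- The conflicts of a hexagon with its pendant edges, including the possible ones. -/
def hexagonPairs : List (ℕ × ℕ) :=
  [(2, 4), (3, 4), (10, 4), (4, 5), (4, 9), (4, 7), (4, 6), (0, 2), (2, 3), (1, 2), (8, 2),
    (2, 5), (2, 7), (0, 3), (0, 10), (0, 1), (0, 11), (0, 5), (6, 0), (3, 10), (1, 3), (3,
    11), (3, 5), (3, 7), (1, 10), (10, 11), (8, 10), (9, 10), (1, 11), (1, 8), (1, 5), (1,
    9), (8, 11), (9, 11), (7, 11), (6, 11), (8, 9), (7, 8), (6, 8), (5, 9), (5, 7), (5, 6),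
    (7, 9), (6, 9), (6, 7)]

/-- The conflicts of a pentagon with its pendant edges, two of which share their outer end,
including the possible ones. -/
def squarePentagonPairs : List (ℕ × ℕ) :=
  [(2, 8), (2, 4), (2, 7), (2, 9), (2, 5), (0, 2), (1, 2), (2, 3), (6, 8), (7, 8), (8, 9),
    (5, 8), (0, 8), (1, 8), (3, 8), (4, 6), (4, 7), (4, 9), (4, 5), (0, 4), (3, 4), (6, 7),
    (6, 9), (5, 6), (0, 6), (1, 6), (7, 9), (5, 7), (1, 7), (3, 7), (5, 9), (0, 9), (1, 9),
    (3, 9), (0, 5), (1, 5), (3, 5), (0, 1), (0, 3), (1, 3)]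

/-- The pairs of `F`, where those in `X` are kept only if they are in `Y`. -/
def selectPairs (F X Y : List (ℕ × ℕ)) : List (ℕ × ℕ) :=
  F.filter fun e => !X.contains e || Y.contains e

/-- The exponents encoded by `addFirsts k Y` are at most `3`, increased by one for every pair of
`Y` that starts there, at the even positions and at most `5` at the odd ones. -/
def isBounded (n k : ℕ) (Y : List (ℕ × ℕ)) : Bool :=
  Nat.blt (addFirsts k Y) (16 ^ n) && (List.range n).all fun x =>
    Nat.ble (hexDigit (addFirsts k Y) x) (if x % 2 = 0 then 3 + (Y.filter (·.1 == x)).length else 5)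

/-- The exponents used for the pentagon if no two pendant edges at distance two are in conflict. -/
def pentagonKey : ℕ := ofHexDigits [0, 5, 2, 5, 3, 5, 3, 5, 3, 4]

/-- The exponents used for the hexagon if no opposite pendant edges are in conflict. -/
def hexagonKey : ℕ := ofHexDigits [3, 5, 2, 4, 0, 5, 3, 5, 2, 5, 3, 5]

/-- The pairs of pendant edges of a pentagon that may be in conflict. The exponent of the first
entry of a pair is raised by one if it is present. -/
def pentagonChords : List (ℕ × ℕ) := [(4, 0), (2, 6), (4, 8), (6, 0), (2, 8)]

/-- The pairs of pendant edges of a hexagon that may be in conflict, ordered as in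
`pentagonChords`. -/
def hexagonChords : List (ℕ × ℕ) := [(6, 0), (8, 2), (10, 4)]

theorem isNonzeroConst_pentagon : pentagonChords.sublists.all (fun Y =>
    isBounded 10 pentagonKey Y && isNonzeroConst (expandEdges (fun _ => true)
      (selectPairs pentagonPairs pentagonChords Y)
      [(addFirsts pentagonKey Y, 1)])) = true := by
  decide +kernel

theorem isNonzeroConst_hexagon : hexagonChords.sublists.all (fun Y =>
    isBounded 12 hexagonKey Y && isNonzeroConst (expandEdges (fun _ => true)
      (selectPairs hexagonPairs hexagonChords Y)
      [(addFirsts hexagonKey Y, 1)])) = true := by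
  decide +kernel

/-- The pairs of pendant edges in `squarePentagonPairs` that may be in conflict, ordered as in
`pentagonChords`. -/
def squarePentagonChords : List (ℕ × ℕ) := [(0, 6), (0, 4)]

/-- The exponents used for `squarePentagonPairs` if none of `squarePentagonChords` is present. -/
def squarePentagonKey : ℕ := ofHexDigits [3, 6, 1, 6, 3, 5, 3, 5, 0, 6]

theorem isNonzeroConst_squarePentagon : squarePentagonChords.sublists.all (fun Y =>
    isNonzeroConst (expandEdges (fun _ => true)
      (selectPairs squarePentagonPairs squarePentagonChords Y)
      [(addFirsts squarePentagonKey Y, 1)]) &&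
    (List.range 10).all fun x => Nat.ble (hexDigit (addFirsts squarePentagonKey Y) x)
      (hexDigit squarePentagonKey x + if x = 0 then Y.length else 0)) = true := by
  decide +kernel

/-! ### Models of cycles with pendant edges -/

/-- `a` and `b` are the same, or they form a pair of `M`, in some order. -/
def PairAdj (M : List (ℕ × ℕ)) (a b : ℕ) : Prop := a = b ∨ (a, b) ∈ M ∨ (b, a) ∈ M

instance (M : List (ℕ × ℕ)) (a b : ℕ) : Decidable (PairAdj M a b) :=
  inferInstanceAs (Decidable (_ ∨ _))

/-- `M` contains the conflicts of a cycle of length `g` with its pendant edges: `2 * i + 1` stands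
for the `i`-th edge of the cycle, `2 * i` for the pendant edge at its end. -/
def IsWheel (g : ℕ) (M : List (ℕ × ℕ)) : Prop :=
  ∀ i < g, PairAdj M (2 * i + 1) (2 * ((i + 1) % g) + 1) ∧
    PairAdj M (2 * i + 1) (2 * ((i + 2) % g) + 1) ∧
    PairAdj M (2 * i) (2 * ((i + 1) % g)) ∧ PairAdj M (2 * i) (2 * i + 1) ∧
    PairAdj M (2 * i) (2 * ((i + 1) % g) + 1) ∧ PairAdj M (2 * i) (2 * ((i + 2) % g) + 1) ∧
    PairAdj M (2 * ((i + 1) % g)) (2 * i + 1)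

instance (g : ℕ) (M : List (ℕ × ℕ)) : Decidable (IsWheel g M) :=
  inferInstanceAs (Decidable (∀ i < g, _))

theorem IsWheel.mono {g : ℕ} {M N : List (ℕ × ℕ)} (h : IsWheel g M) (hMN : M ⊆ N) :
    IsWheel g N := by
  have key : ∀ {a b}, PairAdj M a b → PairAdj N a b := fun h =>
    h.imp_right fun h => h.imp (fun h => hMN h) fun h => hMN h
  intro i hi
  obtain ⟨h1, h2, h3, h4, h5, h6, h7⟩ := h i hi
  exact ⟨key h1, key h2, key h3, key h4, key h5, key h6, key h7⟩

theorem mem_ladder {n j : ℕ} (hj : j < n) {e : ℕ × ℕ} (he : e ∈ ladderBlock j) : e ∈ ladder n := by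
  induction n with
  | zero => omega
  | succ n ih =>
    rcases Nat.lt_succ_iff_lt_or_eq.1 hj with h | rfl
    · exact List.mem_append_right _ (ih h)
    · exact List.mem_append_left _ he

theorem isWheel_wheel {g : ℕ} (hg : 5 ≤ g) : IsWheel g (wheel g) := by
  have h : ∀ {a b : ℕ} (j : ℕ), j < g → (a, b) ∈ ladderBlock j → PairAdj (wheel g) a b :=
    fun j hj he => Or.inr (Or.inl (List.mem_append_right _ (mem_ladder hj he)))
  have h' : ∀ {a b : ℕ} (j : ℕ), j < g → (b, a) ∈ ladderBlock j → PairAdj (wheel g) a b :=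
    fun j hj he => Or.inr (Or.inr (List.mem_append_right _ (mem_ladder hj he)))
  have hc : ∀ {a b : ℕ}, (a, b) ∈ wheelClosure g → PairAdj (wheel g) a b :=
    fun he => Or.inr (Or.inl (List.mem_append_left _ he))
  have hc' : ∀ {a b : ℕ}, (b, a) ∈ wheelClosure g → PairAdj (wheel g) a b :=
    fun he => Or.inr (Or.inr (List.mem_append_left _ he))
  have hb1 : ∀ j, (2 * j, 2 * j + 1) ∈ ladderBlock j := fun j => by
    rcases j with _ | _ | j <;> simp [ladderBlock, mul_add]
  have hb2 : ∀ j, (2 * (j + 1), 2 * j) ∈ ladderBlock (j + 1) ∧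
      (2 * (j + 1), 2 * j + 1) ∈ ladderBlock (j + 1) ∧
      (2 * (j + 1) + 1, 2 * j) ∈ ladderBlock (j + 1) ∧
      (2 * (j + 1) + 1, 2 * j + 1) ∈ ladderBlock (j + 1) := fun j => by
    rcases j with _ | j <;> simp [ladderBlock, mul_add]
  have hb3 : ∀ j, (2 * (j + 2) + 1, 2 * j) ∈ ladderBlock (j + 2) ∧
      (2 * (j + 2) + 1, 2 * j + 1) ∈ ladderBlock (j + 2) := fun j => by
    simp [ladderBlock, mul_add]
  intro i hi
  rcases Nat.lt_or_ge (i + 2) g with h2 | h2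
  · rw [Nat.mod_eq_of_lt h2, Nat.mod_eq_of_lt (by omega : i + 1 < g)]
    have a := hb2 i
    have b := hb3 i
    exact ⟨h' _ (by omega) a.2.2.2, h' _ h2 b.2, h' _ (by omega) a.1, h _ hi (hb1 i),
      h' _ (by omega) a.2.2.1, h' _ h2 b.1, h _ (by omega) a.2.1⟩
  rcases Nat.lt_or_ge (i + 1) g with h1 | h1
  · obtain rfl : g = i + 2 := by omega
    rw [Nat.mod_self, Nat.mod_eq_of_lt h1]
    have a := hb2 i
    refine ⟨h' _ h1 a.2.2.2, hc ?_, h' _ h1 a.1, h _ hi (hb1 i), h' _ h1 a.2.2.1, hc ?_,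
      h _ h1 a.2.1⟩ <;> simp [wheelClosure] <;> omega
  · obtain rfl : g = i + 1 := by omega
    have e1 : (i + 1 + 1) % (i + 1) = 1 := by
      rw [Nat.add_mod_left]; exact Nat.mod_eq_of_lt (by omega)
    rw [show i + 2 = i + 1 + 1 from rfl, e1, Nat.mod_self]
    refine ⟨hc ?_, hc ?_, hc ?_, h _ hi (hb1 i), hc ?_, hc ?_, hc' ?_⟩ <;>
      simp [wheelClosure] <;> omega

theorem selectPairs_mono (F X Y : List (ℕ × ℕ)) : selectPairs F X [] ⊆ selectPairs F X Y := by
  intro e he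
  simp only [selectPairs, List.mem_filter] at he ⊢
  exact ⟨he.1, by simpa using Or.inl (by simpa using he.2)⟩

theorem mem_selectPairs {F X Y : List (ℕ × ℕ)} {e : ℕ × ℕ} (hF : e ∈ F) (hY : e ∈ Y) :
    e ∈ selectPairs F X Y :=
  List.mem_filter.2 ⟨hF, by simp [hY]⟩

open Classical in
/-- The checks for all sets of additional conflicts give a model for an arbitrary relation `W` that
holds only for possible conflicts. -/
theorem exists_isWheel_of_check {g k : ℕ} {F X : List (ℕ × ℕ)} (hX : X.Nodup)
    (hX' : ∀ e ∈ X, e.1 % 2 = 0 ∧ e.2 % 2 = 0 ∧ e.1 < 2 * g ∧ e.2 < 2 * g)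
    (hF : IsWheel g (selectPairs F X [])) (hXF : ∀ e ∈ X, e ∈ F)
    (h : X.sublists.all (fun Y => isBounded (2 * g) k Y && isNonzeroConst
      (expandEdges (fun _ => true) (selectPairs F X Y) [(addFirsts k Y, 1)])) = true)
    (W : ℕ → ℕ → Prop) (hWs : ∀ i j, W i j → W j i)
    (hW : ∀ i < g, ∀ j < g, W i j → i ≠ j → (2 * i, 2 * j) ∈ X ∨ (2 * j, 2 * i) ∈ X) :
    ∃ M t, orientCount M t ≠ 0 ∧ IsWheel g M ∧
      (∀ i < g, ∀ j < g, W i j → PairAdj M (2 * i) (2 * j)) ∧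
      ∀ i < g, t (2 * i) ≤ 3 + ((Finset.range g).filter (W i)).card ∧ t (2 * i + 1) ≤ 5 := by
  set Y := X.filter fun e => decide (W (e.1 / 2) (e.2 / 2)) with hY
  have hYX : Y ∈ X.sublists := List.mem_sublists.2 List.filter_sublist
  obtain ⟨hb, hc⟩ := Bool.and_eq_true_iff.1 (List.all_eq_true.1 h Y hYX)
  refine ⟨_, _, orientCount_hexDigit_ne_zero hc, hF.mono ?_, ?_, ?_⟩
  · exact selectPairs_mono F X Y
  · intro i hi j hj hij
    by_cases hne : i = j
    · exact Or.inl (by rw [hne])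
    have key : ∀ i j, W i j → (2 * i, 2 * j) ∈ X → (2 * i, 2 * j) ∈ selectPairs F X Y := by
      intro i j hij hx
      exact mem_selectPairs (hXF _ hx) (List.mem_filter.2 ⟨hx, by simpa using hij⟩)
    exact Or.inr ((hW i hi j hj hij hne).imp (key i j hij) (key j i (hWs i j hij)))
  · simp only [isBounded, Bool.and_eq_true, List.all_eq_true, List.mem_range, Nat.ble_eq] at hb
    intro i hi
    have h1 := hb.2 (2 * i) (by omega)
    have h2 := hb.2 (2 * i + 1) (by omega)
    rw [if_pos (by omega)] at h1
    rw [if_neg (by omega)] at h2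
    refine ⟨h1.trans (Nat.add_le_add_left ?_ 3), h2⟩
    rw [← List.toFinset_card_of_nodup ((hX.filter _).filter _)]
    refine Finset.card_le_card_of_injOn (fun e => e.2 / 2) ?_ ?_
    · intro e he
      simp only [List.coe_toFinset, List.mem_filter, beq_iff_eq, decide_eq_true_eq,
        Set.mem_ofPred_eq] at he
      have := hX' e he.1.1
      simp only [Finset.coe_filter, Finset.mem_range, Set.mem_ofPred_eq]
      refine ⟨by omega, ?_⟩
      have h3 := he.1.2
      rwa [he.2, Nat.mul_div_cancel_left _ (by norm_num)] at h3
    · intro e he f hf hef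
      simp only [List.coe_toFinset, List.mem_filter, beq_iff_eq, decide_eq_true_eq,
        Set.mem_ofPred_eq] at he hf
      have h3 := hX' e he.1.1
      have h4 := hX' f hf.1.1
      have : e.2 / 2 = f.2 / 2 := hef
      exact Prod.ext (by omega) (by omega)

set_option synthInstance.maxHeartbeats 200000 in
set_option synthInstance.maxSize 1000 in
theorem mem_pentagonChords : ∀ i < 5, ∀ j < 5, i ≠ j → j = (i + 2) % 5 ∨ i = (j + 2) % 5 →
    (2 * i, 2 * j) ∈ pentagonChords ∨ (2 * j, 2 * i) ∈ pentagonChords := by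
  decide

set_option synthInstance.maxHeartbeats 200000 in
set_option synthInstance.maxSize 1000 in
theorem mem_hexagonChords : ∀ i < 6, ∀ j < 6, i ≠ j → j = (i + 3) % 6 →
    (2 * i, 2 * j) ∈ hexagonChords ∨ (2 * j, 2 * i) ∈ hexagonChords := by
  decide

open Classical in
/-- The model of the conflicts of a shortest cycle with its pendant edges. Here `W i j` says that
the outer ends of the pendant edges `2 * i` and `2 * j` are adjacent. -/
theorem exists_isWheel {g : ℕ} (hg : 5 ≤ g) (W : ℕ → ℕ → Prop) (hWs : ∀ i j, W i j → W j i)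
    (hW : ∀ i < g, ∀ j < g, W i j → i = j ∨ (g = 5 ∧ (j = (i + 2) % 5 ∨ i = (j + 2) % 5)) ∨
      (g = 6 ∧ j = (i + 3) % 6)) :
    ∃ M t, orientCount M t ≠ 0 ∧ IsWheel g M ∧
      (∀ i < g, ∀ j < g, W i j → PairAdj M (2 * i) (2 * j)) ∧
      ∀ i < g, t (2 * i) ≤ 3 + ((Finset.range g).filter (W i)).card ∧ t (2 * i + 1) ≤ 5 := by
  by_cases h5 : g = 5
  · subst h5
    refine exists_isWheel_of_check (g := 5) (k := pentagonKey) (X := pentagonChords)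
      (F := pentagonPairs) (by decide) (by decide) (by decide +kernel) (by decide)
      isNonzeroConst_pentagon W hWs fun i hi j hj hij hne => ?_
    rcases hW i hi j hj hij with h | h | h
    · exact absurd h hne
    · exact mem_pentagonChords i hi j hj hne h.2
    · omega
  by_cases h6 : g = 6
  · subst h6
    refine exists_isWheel_of_check (g := 6) (k := hexagonKey) (X := hexagonChords)
      (F := hexagonPairs) (by decide) (by decide) (by decide +kernel) (by decide)
      isNonzeroConst_hexagon W hWs fun i hi j hj hij hne => ?_
    rcases hW i hi j hj hij with h | h | h
    · exact absurd h hne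
    · omega
    · exact mem_hexagonChords i hi j hj hne h.2
  · obtain ⟨t, ht, hb⟩ := exists_orientCount_wheel_ne_zero (g := g) (by omega)
    refine ⟨_, t, ht, isWheel_wheel hg, fun i hi j hj hij => ?_, fun i hi => ⟨?_, ?_⟩⟩
    · rcases hW i hi j hj hij with h | h | h
      · exact Or.inl (by rw [h])
      · omega
      · omega
    · have := hb (2 * i)
      rw [if_pos (by omega)] at this
      omega
    · have := hb (2 * i + 1)
      rwa [if_neg (by omega)] at this

open Classical in
/-- The model for a pentagon with two pendant edges that share their outer end; `p` and `q` say
which of the two possible conflicts are present. -/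
theorem exists_squarePentagon (p q : Prop) : ∃ M t, orientCount M t ≠ 0 ∧
    selectPairs squarePentagonPairs squarePentagonChords [] ⊆ M ∧
    (p → (0, 6) ∈ M) ∧ (q → (0, 4) ∈ M) ∧
    t 0 ≤ 3 + (if p then 1 else 0) + (if q then 1 else 0) ∧
    t 1 ≤ 6 ∧ t 2 ≤ 6 ∧ t 3 ≤ 6 ∧ t 4 ≤ 3 ∧ t 5 ≤ 6 ∧ t 6 ≤ 3 ∧ t 7 ≤ 5 ∧ t 8 ≤ 0 ∧ t 9 ≤ 6 := by
  set Y : List (ℕ × ℕ) := (if p then [(0, 6)] else []) ++ if q then [(0, 4)] else [] with hY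
  have hYX : Y ∈ squarePentagonChords.sublists := by
    rw [hY]
    split_ifs <;> simp [squarePentagonChords]
  obtain ⟨hc, hb⟩ := Bool.and_eq_true_iff.1
    (List.all_eq_true.1 isNonzeroConst_squarePentagon Y hYX)
  simp only [List.all_eq_true, List.mem_range, Nat.ble_eq] at hb
  refine ⟨_, _, orientCount_hexDigit_ne_zero hc, selectPairs_mono _ _ _, ?_, ?_, ?_,
    hb 1 (by norm_num), (hb 2 (by norm_num)).trans (by rw [if_neg (by norm_num)]; decide),
    (hb 3 (by norm_num)).trans (by rw [if_neg (by norm_num)]; decide), hb 4 (by norm_num),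
    (hb 5 (by norm_num)).trans (by rw [if_neg (by norm_num)]; decide), hb 6 (by norm_num),
    hb 7 (by norm_num), hb 8 (by norm_num), hb 9 (by norm_num)⟩
  · intro hp
    exact mem_selectPairs (by decide) (by simp [hY, hp])
  · intro hq
    exact mem_selectPairs (by decide) (by simp [hY, hq])
  · have h0 := hb 0 (by norm_num)
    have h3 : hexDigit squarePentagonKey 0 = 3 := by decide
    have hlen : Y.length = (if p then 1 else 0) + if q then 1 else 0 := by
      rw [hY]
      split_ifs <;> rfl
    rw [h3, hlen, if_pos rfl] at h0
    omega

/-! ### Colouring all edges after a core -/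

/-- Greedy colouring, in the order of decreasing rank. -/
theorem exists_listColoring_of_rank {ι : Type u} {C : Type w} [Nonempty C] (R : ι → ι → Prop)
    (hR : ∀ i j, R i j → R j i) (hR' : ∀ i, ¬ R i i) (r : ι → ℕ) (L : ι → Finset C)
    (A : Finset ι) (h : ∀ i ∈ A, ∃ B : Finset ι, (∀ j ∈ A, R i j → r i ≤ r j → j ∈ B) ∧
      B.card < (L i).card) :
    ∃ φ : ι → C, (∀ i ∈ A, φ i ∈ L i) ∧ ∀ i ∈ A, ∀ j ∈ A, R i j → φ i ≠ φ j := by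
  classical
  induction A using Finset.strongInduction with
  | H A ih =>
    rcases A.eq_empty_or_nonempty with rfl | hA
    · exact ⟨fun _ => Classical.arbitrary C, by simp, by simp⟩
    obtain ⟨i, hi, hmin⟩ := A.exists_min_image r hA
    obtain ⟨φ, hφ, hφ'⟩ := ih (A.erase i) (Finset.erase_ssubset hi) fun j hj => by
      obtain ⟨B, hB, hB'⟩ := h j (Finset.mem_of_mem_erase hj)
      exact ⟨B, fun k hk => hB k (Finset.mem_of_mem_erase hk), hB'⟩
    obtain ⟨B, hB, hB'⟩ := h i hi
    obtain ⟨c, hc, hcB⟩ := Finset.exists_mem_notMem_of_card_lt_card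
      (Finset.card_image_le.trans_lt hB' : (B.image φ).card < (L i).card)
    have hc' : ∀ j ∈ A, R i j → φ j ≠ c := by
      rintro j hj hij rfl
      exact hcB (Finset.mem_image_of_mem φ (hB j hj hij (hmin j hj)))
    have hne : ∀ j, R i j → j ≠ i := by
      rintro j hij rfl
      exact hR' j hij
    refine ⟨Function.update φ i c, fun j hj => ?_, fun j hj k hk hjk => ?_⟩
    · by_cases hji : j = i
      · subst hji
        simpa using hc
      · rw [Function.update_of_ne hji]
        exact hφ j (Finset.mem_erase.2 ⟨hji, hj⟩)
    · by_cases hji : j = i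
      · subst hji
        rw [Function.update_self, Function.update_of_ne (hne k hjk)]
        exact (hc' k hk hjk).symm
      · by_cases hki : k = i
        · subst hki
          rw [Function.update_self, Function.update_of_ne hji]
          exact hc' j hj (hR _ _ hjk)
        · rw [Function.update_of_ne hji, Function.update_of_ne hki]
          exact hφ' j (Finset.mem_erase.2 ⟨hji, hj⟩) k (Finset.mem_erase.2 ⟨hki, hk⟩) hjk

theorem exists_fin_listColoring {n : ℕ} {M : List (ℕ × ℕ)} {t : ℕ → ℕ} (h : orientCount M t ≠ 0)
    {C : Type w} (l : Fin n → Finset C) (hl : ∀ i : Fin n, t i < (l i).card) :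
    ∃ ψ : Fin n → C, (∀ i, ψ i ∈ l i) ∧ ∀ i j : Fin n, i ≠ j → PairAdj M i j → ψ i ≠ ψ j := by
  classical
  -- The vertices of the model outside `Fin n` receive lists of new colours.
  obtain ⟨ψ, hψ, hψ'⟩ := exists_listColoring_of_orientCount_ne_zero M t h
    (fun i => if hi : i < n then (l ⟨i, hi⟩).map Function.Embedding.inl
      else (Finset.range (t i + 1)).map (Function.Embedding.inr : ℕ ↪ C ⊕ ℕ)) (fun i => by
      split_ifs with hi
      · simpa using hl ⟨i, hi⟩
      · simp)
  have hex : ∀ i : Fin n, ∃ c ∈ l i, Sum.inl c = ψ i := fun i => by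
    have := hψ i
    rw [dif_pos i.2] at this
    simpa using this
  choose χ hχ hχ' using hex
  refine ⟨χ, hχ, fun i j hij hM hcon => ?_⟩
  have he : ψ i = ψ j := by rw [← hχ', ← hχ', hcon]
  rcases hM with hM | hM | hM
  · exact hij (Fin.ext hM)
  · exact hψ' _ hM he
  · exact hψ' _ hM he.symm

namespace SimpleGraph

variable {V : Type u}

/-- Two distinct edges at distance at most one: they share an endvertex or are joined by an
edge. -/
def StrongAdj (G : SimpleGraph V) (e f : Sym2 V) : Prop :=
  e ≠ f ∧ ∃ x ∈ e, ∃ y ∈ f, x = y ∨ G.Adj x y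

theorem StrongAdj.symm {G : SimpleGraph V} {e f : Sym2 V} (h : G.StrongAdj e f) :
    G.StrongAdj f e := by
  obtain ⟨hne, x, hx, y, hy, h⟩ := h
  exact ⟨hne.symm, y, hy, x, hx, h.imp Eq.symm fun h => h.symm⟩

/-- `G` has a strong edge-colouring from the lists `L` on the component of `v`. -/
def IsStrongColorableAt (G : SimpleGraph V) {C : Type w} (L : Sym2 V → Finset C) (v : V) : Prop :=
  ∃ φ : Sym2 V → C, ∀ e ∈ G.edgeSet, (∃ x ∈ e, G.Reachable v x) → φ e ∈ L e ∧
    ∀ f ∈ G.edgeSet, (∃ x ∈ f, G.Reachable v x) → G.StrongAdj e f → φ e ≠ φ f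

/-- Every vertex reachable from `S` and outside `S` has a neighbour that is closer to `S`. -/
theorem exists_rank (G : SimpleGraph V) (S : Set V) :
    ∃ r : V → ℕ, ∀ s ∈ S, ∀ x, G.Reachable s x → x ∉ S → ∃ u, G.Adj u x ∧ r u < r x := by
  refine ⟨fun x => sInf {n | ∃ s ∈ S, ∃ p : G.Walk s x, p.length = n}, fun s hs x hx hxS => ?_⟩
  have hne : {n | ∃ s ∈ S, ∃ p : G.Walk s x, p.length = n}.Nonempty := by
    obtain ⟨p⟩ := hx
    exact ⟨_, s, hs, p, rfl⟩
  obtain ⟨s', hs', p, hp⟩ := Nat.sInf_mem hne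
  dsimp only
  rw [← hp]
  clear hp hne hx
  have hlen : p.reverse.length = p.length := p.length_reverse
  generalize p.reverse = q at hlen
  cases q with
  | nil => exact absurd hs' hxS
  | @cons _ u _ h q =>
    refine ⟨u, h.symm, ?_⟩
    rw [← hlen, Walk.length_cons, Nat.lt_succ_iff]
    exact Nat.sInf_le ⟨s', hs', q.reverse, q.length_reverse⟩

open Classical in
/-- The neighbours of a vertex. -/
noncomputable def nbrs (G : SimpleGraph V) [Fintype V] (v : V) : Finset V :=
  Finset.univ.filter (G.Adj v)

open Classical in
/-- The vertices outside `e` that are adjacent to an end of `e`. -/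
noncomputable def edgeNbrs (G : SimpleGraph V) [Fintype V] (e : Sym2 V) : Finset V :=
  Finset.univ.filter fun y => y ∉ e ∧ ∃ x ∈ e, G.Adj x y

open Classical in
/-- The number of edges at `y` that are not in `K`. -/
noncomputable def outDegree (G : SimpleGraph V) [Fintype V] (K : Set (Sym2 V)) (y : V) : ℕ :=
  ((G.nbrs y).filter fun z => s(y, z) ∉ K).card

/-- The number of edges outside `K` at the vertices of `edgeNbrs e`, counted with multiplicity. It
bounds the number of edges outside `K` that are close to `e`. -/
noncomputable def load (G : SimpleGraph V) [Fintype V] (K : Set (Sym2 V)) (e : Sym2 V) : ℕ :=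
  ∑ y ∈ G.edgeNbrs e, G.outDegree K y

variable {G : SimpleGraph V} [Fintype V]

@[simp]
theorem mem_nbrs {v w : V} : w ∈ G.nbrs v ↔ G.Adj v w := by
  simp [nbrs]

theorem mem_edgeNbrs {e : Sym2 V} {y : V} :
    y ∈ G.edgeNbrs e ↔ y ∉ e ∧ ∃ x ∈ e, G.Adj x y := by
  simp [edgeNbrs]

theorem edgeNbrs_mk (a b : V) [DecidableEq V] :
    G.edgeNbrs s(a, b) = ((G.nbrs a ∪ G.nbrs b).erase a).erase b := by
  ext y
  simp only [mem_edgeNbrs, Sym2.mem_iff, not_or, exists_eq_or_imp, exists_eq_left,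
    Finset.mem_erase, Finset.mem_union, mem_nbrs]
  tauto

theorem outDegree_le_card (K : Set (Sym2 V)) (y : V) : G.outDegree K y ≤ (G.nbrs y).card := by
  classical
  exact Finset.card_filter_le _ _

theorem StrongAdj.exists_mem_edgeNbrs {e f : Sym2 V} (h : G.StrongAdj e f)
    (hf : f ∈ G.edgeSet) : ∃ y ∈ f, y ∈ G.edgeNbrs e := by
  obtain ⟨hne, x, hx, y, hy, hxy⟩ := h
  have key : ∀ z ∈ e, z ∈ f → ∃ y ∈ f, y ∈ G.edgeNbrs e := by
    intro z hz hzf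
    obtain ⟨w, rfl⟩ := Sym2.mem_iff_exists.1 hzf
    refine ⟨w, Sym2.mem_mk_right _ _, mem_edgeNbrs.2 ⟨fun hw => hne ?_, z, hz, hf⟩⟩
    exact (Sym2.mem_and_mem_iff (G.ne_of_adj hf)).1 ⟨hz, hw⟩
  rcases hxy with rfl | hxy
  · exact key x hx hy
  · by_cases hye : y ∈ e
    · exact key y hye hy
    · exact ⟨y, hy, mem_edgeNbrs.2 ⟨hye, x, hx, hxy⟩⟩

theorem card_nbrs_erase_le (hG : ∀ v, (G.nbrs v).card ≤ 3) {a b : V} [DecidableEq V]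
    (hab : G.Adj a b) : ((G.nbrs a).erase b).card ≤ 2 := by
  rw [Finset.card_erase_of_mem (mem_nbrs.2 hab)]
  have := hG a
  omega

theorem card_edgeNbrs_le (hG : ∀ v, (G.nbrs v).card ≤ 3) {e : Sym2 V} (he : e ∈ G.edgeSet) :
    (G.edgeNbrs e).card ≤ 4 := by
  classical
  induction e with
  | _ a b =>
    have hab : G.Adj a b := he
    rw [edgeNbrs_mk]
    have : ((G.nbrs a ∪ G.nbrs b).erase a).erase b ⊆ (G.nbrs a).erase b ∪ (G.nbrs b).erase a := by
      intro y
      simp only [Finset.mem_erase, Finset.mem_union]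
      tauto
    have h1 := Finset.card_le_card this
    have h2 := Finset.card_union_le ((G.nbrs a).erase b) ((G.nbrs b).erase a)
    have h3 := card_nbrs_erase_le hG hab
    have h4 := card_nbrs_erase_le hG hab.symm
    omega

open Classical in
/-- The edges outside `K` with an end in `T`. -/
noncomputable def outEdges (G : SimpleGraph V) (K : Set (Sym2 V)) (T : Finset V) :
    Finset (Sym2 V) :=
  T.biUnion fun y => ((G.nbrs y).filter fun z => s(y, z) ∉ K).image fun z => s(y, z)

theorem card_outEdges_le (K : Set (Sym2 V)) (T : Finset V) :
    (G.outEdges K T).card ≤ ∑ y ∈ T, G.outDegree K y := by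
  classical
  exact Finset.card_biUnion_le.trans (Finset.sum_le_sum fun y _ => Finset.card_image_le)

theorem mem_outEdges {K : Set (Sym2 V)} {T : Finset V} {f : Sym2 V} (hf : f ∈ G.edgeSet)
    (hK : f ∉ K) {y : V} (hy : y ∈ f) (hyT : y ∈ T) : f ∈ G.outEdges K T := by
  classical
  obtain ⟨z, rfl⟩ := Sym2.mem_iff_exists.1 hy
  refine Finset.mem_biUnion.2 ⟨y, hyT, Finset.mem_image_of_mem _ ?_⟩
  exact Finset.mem_filter.2 ⟨mem_nbrs.2 hf, hK⟩

/-- Core lemma: the edges outside the core `κ` are coloured greedily towards `S`; each edge of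
the core then keeps enough colours for the Alon–Tarsi criterion to apply to the model `M` of the
core. -/
theorem isStrongColorableAt_of_core (hG : ∀ v, (G.nbrs v).card ≤ 3) {C : Type w} [Nonempty C]
    {L : Sym2 V → Finset C} (hL : ∀ e ∈ G.edgeSet, 10 ≤ (L e).card) (S : Set V) {n : ℕ}
    (κ : Fin n → Sym2 V) (hκ : Function.Injective κ) (hκE : ∀ i, κ i ∈ G.edgeSet)
    {M : List (ℕ × ℕ)} {t : ℕ → ℕ} (hM : orientCount M t ≠ 0)
    (hconf : ∀ i j, i ≠ j → G.StrongAdj (κ i) (κ j) → PairAdj M i j)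
    (hcore : ∀ i, G.load (Set.range κ) (κ i) + t i ≤ 9)
    (hS : ∀ e ∈ G.edgeSet, e ∉ Set.range κ → (∃ x ∈ e, x ∈ S) → G.load (Set.range κ) e ≤ 9)
    {v : V} (hv : v ∈ S) : G.IsStrongColorableAt L v := by
  classical
  obtain ⟨r, hr⟩ := exists_rank G S
  set A : Finset (Sym2 V) := Finset.univ.filter fun e =>
    e ∈ G.edgeSet ∧ e ∉ Set.range κ ∧ ∃ x ∈ e, G.Reachable v x with hA
  have hAmem : ∀ {e}, e ∈ A ↔ e ∈ G.edgeSet ∧ e ∉ Set.range κ ∧ ∃ x ∈ e, G.Reachable v x := by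
    intro e
    simp [hA]
  have hsum : ∀ T : Finset V, T.card ≤ 3 → ∑ y ∈ T, G.outDegree (Set.range κ) y ≤ 9 := by
    intro T hT
    refine (Finset.sum_le_card_nsmul T _ 3 fun y _ =>
      (outDegree_le_card _ y).trans (hG y)).trans ?_
    simp only [smul_eq_mul]
    omega
  obtain ⟨φ, hφ, hφ'⟩ := exists_listColoring_of_rank G.StrongAdj (fun _ _ h => h.symm)
    (fun _ h => h.1 rfl) (fun e => sInf (r '' {x | x ∈ e})) L A fun e he => by
      obtain ⟨heE, heK, hev⟩ := hAmem.1 he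
      have hLe := hL e heE
      by_cases heS : ∃ x ∈ e, x ∈ S
      · refine ⟨G.outEdges (Set.range κ) (G.edgeNbrs e), fun f hf hef _ => ?_, ?_⟩
        · obtain ⟨hfE, hfK, -⟩ := hAmem.1 hf
          obtain ⟨y, hy, hye⟩ := hef.exists_mem_edgeNbrs hfE
          exact mem_outEdges hfE hfK hy hye
        · have h1 := card_outEdges_le (G := G) (Set.range κ) (G.edgeNbrs e)
          have h2 := hS e heE heK heS
          unfold load at h2
          omega
      · -- The edges at the neighbour `u` of `e` that is closer to `S` have smaller rank.
        obtain ⟨a, hae, har⟩ : sInf (r '' {x | x ∈ e}) ∈ r '' {x | x ∈ e} := by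
          refine Nat.sInf_mem ?_
          obtain ⟨x, hx, -⟩ := hev
          exact ⟨_, x, hx, rfl⟩
        have hae' : a ∈ e := hae
        have hva : G.Reachable v a := by
          obtain ⟨x, hx, hvx⟩ := hev
          by_cases hxa : x = a
          · rwa [← hxa]
          · have hadj : e = s(x, a) := ((Sym2.mem_and_mem_iff hxa).1 ⟨hx, hae'⟩)
            rw [hadj] at heE
            exact hvx.trans (G.mem_edgeSet.1 heE).reachable
        obtain ⟨u, hua, hur⟩ := hr v hv a hva fun h => heS ⟨a, hae', h⟩
        have hrank : ∀ f : Sym2 V, u ∈ f → sInf (r '' {x | x ∈ f}) < sInf (r '' {x | x ∈ e}) := by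
          intro f hf
          rw [← har]
          exact lt_of_le_of_lt (Nat.sInf_le ⟨u, hf, rfl⟩) hur
        have hue : u ∈ G.edgeNbrs e :=
          mem_edgeNbrs.2 ⟨fun h => lt_irrefl _ (hrank e h), a, hae', hua.symm⟩
        refine ⟨G.outEdges (Set.range κ) ((G.edgeNbrs e).erase u), fun f hf hef hle => ?_, ?_⟩
        · obtain ⟨hfE, hfK, -⟩ := hAmem.1 hf
          obtain ⟨y, hy, hye⟩ := hef.exists_mem_edgeNbrs hfE
          refine mem_outEdges hfE hfK hy (Finset.mem_erase.2 ⟨?_, hye⟩)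
          rintro rfl
          exact absurd (hrank f hy) (not_lt.2 hle)
        · have h1 := card_outEdges_le (G := G) (Set.range κ) ((G.edgeNbrs e).erase u)
          have h2 := hsum ((G.edgeNbrs e).erase u) (by
            rw [Finset.card_erase_of_mem hue]
            have := card_edgeNbrs_le hG heE
            omega)
          omega
  set B : Fin n → Finset (Sym2 V) := fun i => A.filter (G.StrongAdj (κ i)) with hB
  have hBcard : ∀ i, (B i).card ≤ G.load (Set.range κ) (κ i) := by
    intro i
    refine (Finset.card_le_card fun f hf => ?_).trans
      (card_outEdges_le (G := G) (Set.range κ) (G.edgeNbrs (κ i)))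
    obtain ⟨hfA, hif⟩ := Finset.mem_filter.1 hf
    obtain ⟨hfE, hfK, -⟩ := hAmem.1 hfA
    obtain ⟨y, hy, hye⟩ := hif.exists_mem_edgeNbrs hfE
    exact mem_outEdges hfE hfK hy hye
  obtain ⟨ψ, hψ, hψ'⟩ := exists_fin_listColoring hM (fun i => L (κ i) \ (B i).image φ) fun i => by
    have h1 := Finset.le_card_sdiff ((B i).image φ) (L (κ i))
    have h2 := hL _ (hκE i)
    have h3 := hcore i
    have h4 := hBcard i
    have h5 : ((B i).image φ).card ≤ (B i).card := Finset.card_image_le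
    omega
  have hcross : ∀ i, ∀ f ∈ A, G.StrongAdj (κ i) f → ψ i ≠ φ f := by
    intro i f hf hif hcon
    have := (Finset.mem_sdiff.1 (hψ i)).2
    rw [hcon] at this
    exact this (Finset.mem_image_of_mem _ (Finset.mem_filter.2 ⟨hf, hif⟩))
  refine ⟨fun e => if h : ∃ i, κ i = e then ψ h.choose else φ e, fun e he hev => ?_⟩
  have hval : ∀ i, (if h : ∃ j, κ j = κ i then ψ h.choose else φ (κ i)) = ψ i := by
    intro i
    have h : ∃ j, κ j = κ i := ⟨i, rfl⟩
    rw [dif_pos h, hκ h.choose_spec]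
  have hval' : ∀ e, e ∉ Set.range κ →
      (if h : ∃ j, κ j = e then ψ h.choose else φ e) = φ e := fun e h => dif_neg h
  by_cases hek : e ∈ Set.range κ
  · obtain ⟨i, rfl⟩ := hek
    dsimp only
    rw [hval]
    refine ⟨(Finset.mem_sdiff.1 (hψ i)).1, fun f hf hfv hef => ?_⟩
    by_cases hfk : f ∈ Set.range κ
    · obtain ⟨j, rfl⟩ := hfk
      rw [hval]
      have hij : i ≠ j := fun h => hef.1 (by rw [h])
      exact hψ' i j hij (hconf i j hij hef)
    · rw [hval' f hfk]
      exact hcross i f (hAmem.2 ⟨hf, hfk, hfv⟩) hef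
  · dsimp only
    rw [hval' e hek]
    have heA := hAmem.2 ⟨he, hek, hev⟩
    refine ⟨hφ e heA, fun f hf hfv hef => ?_⟩
    by_cases hfk : f ∈ Set.range κ
    · obtain ⟨j, rfl⟩ := hfk
      rw [hval]
      exact (hcross j e heA hef.symm).symm
    · rw [hval' f hfk]
      exact hφ' e heA f (hAmem.2 ⟨hf, hfk, hfv⟩) hef

end SimpleGraph

/-! ### Cycles as cores -/

theorem PairAdj.symm {M : List (ℕ × ℕ)} {a b : ℕ} (h : PairAdj M a b) : PairAdj M b a :=
  h.imp Eq.symm Or.symm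

/-- The conflicts of a wheel, with the indices taken modulo `g`. -/
theorem IsWheel.zmod {g : ℕ} [NeZero g] {M : List (ℕ × ℕ)} (h : IsWheel g M) (i : ZMod g) :
    PairAdj M (2 * i.val + 1) (2 * (i + 1).val + 1) ∧
    PairAdj M (2 * i.val + 1) (2 * (i + 2).val + 1) ∧
    PairAdj M (2 * i.val) (2 * (i + 1).val) ∧ PairAdj M (2 * i.val) (2 * i.val + 1) ∧
    PairAdj M (2 * i.val) (2 * (i + 1).val + 1) ∧ PairAdj M (2 * i.val) (2 * (i + 2).val + 1) ∧
    PairAdj M (2 * (i + 1).val) (2 * i.val + 1) := by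
  have h1 : (i + 1).val = (i.val + 1) % g := by
    rw [← ZMod.val_natCast, Nat.cast_add, ZMod.natCast_zmod_val, Nat.cast_one]
  have h2 : (i + 2).val = (i.val + 2) % g := by
    rw [← ZMod.val_natCast, Nat.cast_add, ZMod.natCast_zmod_val, Nat.cast_ofNat]
  rw [h1, h2]
  exact h i.val (ZMod.val_lt i)

namespace SimpleGraph

variable {V : Type u} {G : SimpleGraph V}

section load

variable [Fintype V]

theorem outDegree_add_card_le (hG : ∀ v, (G.nbrs v).card ≤ 3) {K : Set (Sym2 V)} {y : V}
    (T : Finset V) (hT : ∀ z ∈ T, G.Adj y z ∧ s(y, z) ∈ K) : G.outDegree K y + T.card ≤ 3 := by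
  classical
  refine le_trans ?_ (hG y)
  have h : ((G.nbrs y).filter fun z => s(y, z) ∉ K) ⊆ G.nbrs y \ T := by
    intro z hz
    obtain ⟨hz1, hz2⟩ := Finset.mem_filter.1 hz
    exact Finset.mem_sdiff.2 ⟨hz1, fun hzT => hz2 (hT z hzT).2⟩
  have hsub : T ⊆ G.nbrs y := fun z hz => mem_nbrs.2 (hT z hz).1
  have h1 := Finset.card_le_card h
  rw [Finset.card_sdiff_of_subset hsub] at h1
  have h2 := Finset.card_le_card hsub
  have h3 : G.outDegree K y = ((G.nbrs y).filter fun z => s(y, z) ∉ K).card := by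
    unfold outDegree
    congr
  omega

theorem outDegree_le_three (hG : ∀ v, (G.nbrs v).card ≤ 3) (K : Set (Sym2 V)) (y : V) :
    G.outDegree K y ≤ 3 :=
  (outDegree_le_card K y).trans (hG y)

theorem outDegree_le_two (hG : ∀ v, (G.nbrs v).card ≤ 3) {K : Set (Sym2 V)} {y z : V}
    (h : G.Adj y z) (hK : s(y, z) ∈ K) : G.outDegree K y ≤ 2 := by
  have := outDegree_add_card_le hG {z} (K := K) (y := y) (by simpa using ⟨h, hK⟩)
  rw [Finset.card_singleton] at this
  omega

theorem outDegree_le_one (hG : ∀ v, (G.nbrs v).card ≤ 3) {K : Set (Sym2 V)} {y z z' : V}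
    (hne : z ≠ z') (h : G.Adj y z) (hK : s(y, z) ∈ K) (h' : G.Adj y z') (hK' : s(y, z') ∈ K) :
    G.outDegree K y ≤ 1 := by
  classical
  have := outDegree_add_card_le hG {z, z'} (K := K) (y := y) (by
    simpa using ⟨⟨h, hK⟩, h', hK'⟩)
  rw [Finset.card_pair hne] at this
  omega

theorem outDegree_eq_zero {K : Set (Sym2 V)} {y : V} (h : ∀ z, G.Adj y z → s(y, z) ∈ K) :
    G.outDegree K y = 0 := by
  classical
  unfold outDegree
  rw [Finset.card_eq_zero, Finset.filter_eq_empty_iff]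
  intro z hz
  simpa using h z (mem_nbrs.1 hz)

open Classical in
/-- The number of edges outside `K` at the neighbours of `a` other than `b`. -/
noncomputable def sideLoad (G : SimpleGraph V) (K : Set (Sym2 V)) (a b : V) : ℕ :=
  ∑ y ∈ (G.nbrs a).erase b, G.outDegree K y

theorem load_le_sideLoad_add (K : Set (Sym2 V)) (a b : V) :
    G.load K s(a, b) ≤ G.sideLoad K a b + G.sideLoad K b a := by
  classical
  unfold load sideLoad
  have h : G.edgeNbrs s(a, b) ⊆ (G.nbrs a).erase b ∪ (G.nbrs b).erase a := by
    rw [edgeNbrs_mk]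
    intro y
    simp only [Finset.mem_erase, Finset.mem_union]
    tauto
  refine (Finset.sum_le_sum_of_subset h).trans ?_
  rw [← Finset.sum_union_inter]
  convert Nat.le_add_right _ _

theorem sideLoad_le {K : Set (Sym2 V)} {a b p q : V}
    (h : ∀ x, G.Adj a x → x = b ∨ x = p ∨ x = q) :
    G.sideLoad K a b ≤ G.outDegree K p + G.outDegree K q := by
  classical
  unfold sideLoad
  have hsub : (G.nbrs a).erase b ⊆ {p, q} := by
    intro x hx
    obtain ⟨hxb, hx⟩ := Finset.mem_erase.1 hx
    have := h x (mem_nbrs.1 hx)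
    simp only [Finset.mem_insert, Finset.mem_singleton]
    tauto
  refine (Finset.sum_le_sum_of_subset hsub).trans ?_
  by_cases hpq : p = q
  · subst hpq
    simp
  · rw [Finset.sum_pair hpq]

theorem sideLoad_le_card_mul [DecidableEq V] (hG : ∀ v, (G.nbrs v).card ≤ 3)
    (K : Set (Sym2 V)) (a b : V) :
    G.sideLoad K a b ≤ ((G.nbrs a).erase b).card * 3 := by
  unfold sideLoad
  refine (Finset.sum_le_card_nsmul _ _ 3 fun y _ => outDegree_le_three hG K y).trans ?_
  rw [smul_eq_mul]
  convert le_rfl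

/-- Neighbours of `a` with few edges outside `K` improve the trivial bound `6`. -/
theorem sideLoad_add_le [DecidableEq V] (hG : ∀ v, (G.nbrs v).card ≤ 3) {K : Set (Sym2 V)}
    {a b : V} (hab : G.Adj a b) {T : Finset V} (hT : T ⊆ (G.nbrs a).erase b) {c : ℕ}
    (hc : ∀ y ∈ T, G.outDegree K y + c ≤ 3) : G.sideLoad K a b + T.card * c ≤ 6 := by
  have h2 := card_nbrs_erase_le hG hab
  have h3 : ∀ y ∈ (G.nbrs a).erase b, G.outDegree K y + (if y ∈ T then c else 0) ≤ 3 := by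
    intro y hy
    split_ifs with hyT
    · exact hc y hyT
    · exact outDegree_le_three hG _ _
  have h4 := Finset.sum_le_card_nsmul _ _ 3 h3
  rw [Finset.sum_add_distrib, Finset.sum_ite_mem, Finset.inter_eq_right.2 hT,
    Finset.sum_const, smul_eq_mul, smul_eq_mul] at h4
  have h5 : G.sideLoad K a b = ∑ y ∈ (G.nbrs a).erase b, G.outDegree K y := by
    unfold sideLoad
    convert rfl
  omega

/-- A component with a vertex of degree at most two can be coloured greedily. -/
theorem isStrongColorableAt_of_card_nbrs_le_two (hG : ∀ v, (G.nbrs v).card ≤ 3) {C : Type w}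
    [Nonempty C] {L : Sym2 V → Finset C} (hL : ∀ e ∈ G.edgeSet, 10 ≤ (L e).card) {v : V}
    (hv : (G.nbrs v).card ≤ 2) : G.IsStrongColorableAt L v := by
  classical
  refine isStrongColorableAt_of_core hG hL {v} (n := 0) Fin.elim0 (fun i => i.elim0)
    (fun i => i.elim0) (M := []) (t := 0) (by simp [orientCount]) (fun i => i.elim0)
    (fun i => i.elim0) ?_ rfl
  rintro e he - ⟨x, hxe, hx⟩
  obtain rfl : x = v := hx
  obtain ⟨y, rfl⟩ := Sym2.mem_iff_exists.1 hxe
  have hxy : G.Adj x y := he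
  have h1 := load_le_sideLoad_add (G := G) (Set.range (Fin.elim0 : Fin 0 → Sym2 V)) x y
  have h2 := sideLoad_le_card_mul hG (Set.range (Fin.elim0 : Fin 0 → Sym2 V)) x y
  have h3 := sideLoad_le_card_mul hG (Set.range (Fin.elim0 : Fin 0 → Sym2 V)) y x
  have h4 := card_nbrs_erase_le hG hxy.symm
  rw [Finset.card_erase_of_mem (mem_nbrs.2 hxy)] at h2
  omega

end load

/-- The vertices `v i` form a cycle of length `g`, and `w i` is the third neighbour of `v i`, which
does not lie on the cycle. -/
structure IsCubicCycle (G : SimpleGraph V) (g : ℕ) (v w : ZMod g → V) : Prop where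
  injective : Function.Injective v
  adj_iff : ∀ i x, G.Adj (v i) x ↔ x = v (i - 1) ∨ x = v (i + 1) ∨ x = w i
  ne : ∀ i j, w i ≠ v j

/-- The edges of a cycle and the pendant edges at its vertices. -/
def cycleCore {g : ℕ} (v w : ZMod g → V) : Set (Sym2 V) :=
  {e | ∃ i, e = s(v i, v (i + 1)) ∨ e = s(v i, w i)}

namespace IsCubicCycle

variable {g : ℕ} {v w : ZMod g → V}

theorem adj_succ (h : G.IsCubicCycle g v w) (i : ZMod g) : G.Adj (v i) (v (i + 1)) :=
  (h.adj_iff _ _).2 (Or.inr (Or.inl rfl))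

theorem adj_w (h : G.IsCubicCycle g v w) (i : ZMod g) : G.Adj (v i) (w i) :=
  (h.adj_iff _ _).2 (Or.inr (Or.inr rfl))

theorem eq_of_adj_w (h : G.IsCubicCycle g v w) {i j : ZMod g} (hij : G.Adj (w i) (v j)) :
    w i = w j := by
  rcases (h.adj_iff _ _).1 hij.symm with h' | h' | h'
  · exact absurd h' (h.ne _ _)
  · exact absurd h' (h.ne _ _)
  · exact h'

theorem mem_cycleCore (h : G.IsCubicCycle g v w) {i : ZMod g} {x : V} (hx : G.Adj (v i) x) :
    s(v i, x) ∈ cycleCore v w := by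
  rcases (h.adj_iff _ _).1 hx with rfl | rfl | rfl
  · exact ⟨i - 1, Or.inl (by rw [sub_add_cancel, Sym2.eq_swap])⟩
  · exact ⟨i, Or.inl rfl⟩
  · exact ⟨i, Or.inr rfl⟩

theorem outDegree_v [Fintype V] (h : G.IsCubicCycle g v w) (i : ZMod g) :
    G.outDegree (cycleCore v w) (v i) = 0 :=
  outDegree_eq_zero fun _ hz => h.mem_cycleCore hz

theorem outDegree_w [Fintype V] (h : G.IsCubicCycle g v w) (hG : ∀ v, (G.nbrs v).card ≤ 3)
    (i : ZMod g) : G.outDegree (cycleCore v w) (w i) ≤ 2 :=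
  outDegree_le_two hG (h.adj_w i).symm (by rw [Sym2.eq_swap]; exact h.mem_cycleCore (h.adj_w i))

/-- A vertex close to a cycle edge: the cyclic neighbours or the outer ends. -/
theorem of_mem_edgeNbrs_cycle [Fintype V] (h : G.IsCubicCycle g v w) {i : ZMod g} {y : V}
    (hy : y ∈ G.edgeNbrs s(v i, v (i + 1))) :
    y = v (i - 1) ∨ y = v (i + 2) ∨ y = w i ∨ y = w (i + 1) := by
  obtain ⟨hy, x, hx, hxy⟩ := mem_edgeNbrs.1 hy
  simp only [Sym2.mem_iff, not_or] at hy hx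
  rcases hx with rfl | rfl
  · have := (h.adj_iff _ _).1 hxy
    tauto
  · have := (h.adj_iff _ _).1 hxy
    rw [add_sub_cancel_right, show i + 1 + 1 = i + 2 by ring] at this
    tauto

theorem of_mem_edgeNbrs_pendant [Fintype V] (h : G.IsCubicCycle g v w) {i : ZMod g} {y : V}
    (hy : y ∈ G.edgeNbrs s(v (i + 1), w (i + 1))) :
    y = v i ∨ y = v (i + 2) ∨ G.Adj (w (i + 1)) y := by
  obtain ⟨hy, x, hx, hxy⟩ := mem_edgeNbrs.1 hy
  simp only [Sym2.mem_iff, not_or] at hy hx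
  rcases hx with rfl | rfl
  · have := (h.adj_iff _ _).1 hxy
    rw [add_sub_cancel_right, show i + 1 + 1 = i + 2 by ring] at this
    tauto
  · exact Or.inr (Or.inr hxy)

theorem strongAdj_cycle_cycle [Fintype V] (h : G.IsCubicCycle g v w) {i j : ZMod g}
    (hs : G.StrongAdj s(v i, v (i + 1)) s(v j, v (j + 1))) :
    j = i + 1 ∨ j = i + 2 ∨ i = j + 1 ∨ i = j + 2 := by
  obtain ⟨y, hy, hye⟩ := hs.exists_mem_edgeNbrs (h.adj_succ j)
  have hw := h.ne
  rcases h.of_mem_edgeNbrs_cycle hye with rfl | rfl | rfl | rfl <;>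
    rcases Sym2.mem_iff.1 hy with h' | h'
  · have := h.injective h'
    right; right; left; rw [← this]; ring
  · have := h.injective h'
    right; right; right; rw [show j + 2 = j + 1 + 1 by ring, ← this]; ring
  · exact Or.inr (Or.inl (h.injective h').symm)
  · have := h.injective h'
    left
    rw [← add_right_cancel_iff (a := 1), ← this]; ring
  all_goals exact absurd h' (hw _ _)

theorem strongAdj_cycle_pendant [Fintype V] (h : G.IsCubicCycle g v w) {i j : ZMod g}
    (hs : G.StrongAdj s(v i, v (i + 1)) s(v (j + 1), w (j + 1))) :
    i = j + 2 ∨ j = i + 1 ∨ w (j + 1) = w i ∨ w (j + 1) = w (i + 1) := by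
  obtain ⟨y, hy, hye⟩ := hs.exists_mem_edgeNbrs (h.adj_w _)
  have hw := h.ne
  rcases h.of_mem_edgeNbrs_cycle hye with rfl | rfl | rfl | rfl <;>
    rcases Sym2.mem_iff.1 hy with h' | h'
  · have := h.injective h'
    left; rw [show j + 2 = j + 1 + 1 by ring, ← this]; ring
  · exact absurd h'.symm (hw _ _)
  · have := h.injective h'
    right; left
    rw [← add_right_cancel_iff (a := 1), ← this]; ring
  · exact absurd h'.symm (hw _ _)
  · exact absurd h' (hw _ _)
  · exact Or.inr (Or.inr (Or.inl h'.symm))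
  · exact absurd h' (hw _ _)
  · exact Or.inr (Or.inr (Or.inr h'.symm))

theorem strongAdj_pendant_pendant [Fintype V] (h : G.IsCubicCycle g v w) {i j : ZMod g}
    (hs : G.StrongAdj s(v (i + 1), w (i + 1)) s(v (j + 1), w (j + 1))) :
    i = j + 1 ∨ j = i + 1 ∨ w (i + 1) = w (j + 1) ∨ G.Adj (w (i + 1)) (w (j + 1)) := by
  obtain ⟨y, hy, hye⟩ := hs.exists_mem_edgeNbrs (h.adj_w _)
  have hw := h.ne
  rcases h.of_mem_edgeNbrs_pendant hye with rfl | rfl | hadj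
  · rcases Sym2.mem_iff.1 hy with h' | h'
    · exact Or.inl (h.injective h')
    · exact absurd h'.symm (hw _ _)
  · rcases Sym2.mem_iff.1 hy with h' | h'
    · have := h.injective h'
      right; left
      rw [← add_right_cancel_iff (a := 1), ← this]; ring
    · exact absurd h'.symm (hw _ _)
  · rcases Sym2.mem_iff.1 hy with rfl | rfl
    · exact Or.inr (Or.inr (Or.inl (h.eq_of_adj_w hadj)))
    · exact Or.inr (Or.inr (Or.inr hadj))

/-- The core lemma for a core that consists of a cycle and its pendant edges. -/
theorem isStrongColorableAt [Fintype V] (h : G.IsCubicCycle g v w) (hg : 3 ≤ g)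
    (hG : ∀ v, (G.nbrs v).card ≤ 3) {C : Type*} [Nonempty C]
    {L : Sym2 V → Finset C} (hL : ∀ e ∈ G.edgeSet, 10 ≤ (L e).card)
    {M : List (ℕ × ℕ)} {t : ℕ → ℕ} (hM : orientCount M t ≠ 0) (hMg : IsWheel g M)
    (hPP : ∀ i j, w (i + 1) = w (j + 1) ∨ G.Adj (w (i + 1)) (w (j + 1)) →
      PairAdj M (2 * i.val) (2 * j.val))
    (hCP : ∀ i j, w (j + 1) = w i ∨ w (j + 1) = w (i + 1) →
      PairAdj M (2 * i.val + 1) (2 * j.val))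
    (hC : ∀ i, G.outDegree (cycleCore v w) (w i) + G.outDegree (cycleCore v w) (w (i + 1)) +
      t (2 * i.val + 1) ≤ 9)
    (hP : ∀ i, G.sideLoad (cycleCore v w) (w (i + 1)) (v (i + 1)) + t (2 * i.val) ≤ 9) :
    G.IsStrongColorableAt L (v 0) := by
  have : NeZero g := ⟨by omega⟩
  have h2 : (2 : ZMod g) ≠ 0 := by
    intro h0
    have := (ZMod.natCast_eq_zero_iff 2 g).1 (by exact_mod_cast h0)
    exact absurd (Nat.le_of_dvd (by norm_num) this) (by omega)
  set κ : Fin (2 * g) → Sym2 V := fun x =>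
    if (x : ℕ) % 2 = 1 then s(v ((x / 2 : ℕ) : ZMod g), v (((x / 2 : ℕ) : ZMod g) + 1))
    else s(v (((x / 2 : ℕ) : ZMod g) + 1), w (((x / 2 : ℕ) : ZMod g) + 1)) with hκ
  -- Every element of `Fin (2 * g)` is a cycle edge or a pendant edge with an index modulo `g`.
  have hcases : ∀ x : Fin (2 * g), ∃ i : ZMod g,
      ((x : ℕ) = 2 * i.val + 1 ∧ κ x = s(v i, v (i + 1))) ∨
      ((x : ℕ) = 2 * i.val ∧ κ x = s(v (i + 1), w (i + 1))) := by
    intro x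
    refine ⟨((x / 2 : ℕ) : ZMod g), ?_⟩
    have hv : (((x / 2 : ℕ) : ZMod g)).val = x / 2 := ZMod.val_natCast_of_lt (by omega)
    rcases Nat.mod_two_eq_zero_or_one (x : ℕ) with hx | hx
    · exact Or.inr ⟨by omega, by simp [hκ, hx]⟩
    · exact Or.inl ⟨by omega, by simp [hκ, hx]⟩
  have hrange : Set.range κ = cycleCore v w := by
    ext e
    constructor
    · rintro ⟨x, rfl⟩
      obtain ⟨i, ⟨-, hi⟩ | ⟨-, hi⟩⟩ := hcases x
      · exact ⟨i, Or.inl hi⟩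
      · exact ⟨i + 1, Or.inr hi⟩
    · rintro ⟨i, rfl | rfl⟩
      · have hlt := ZMod.val_lt i
        refine ⟨⟨2 * i.val + 1, by omega⟩, ?_⟩
        simp [hκ, show (2 * i.val + 1) / 2 = i.val by omega]
      · have hlt := ZMod.val_lt (i - 1)
        refine ⟨⟨2 * (i - 1).val, by omega⟩, ?_⟩
        simp [hκ]
  have hval : ∀ {i j : ZMod g}, i = j → i.val = j.val := fun h => by rw [h]
  refine isStrongColorableAt_of_core hG hL (Set.range v) κ ?_ ?_ hM ?_ ?_ ?_ ⟨0, rfl⟩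
  · intro x y hxy
    obtain ⟨i, ⟨hx, hi⟩ | ⟨hx, hi⟩⟩ := hcases x <;> obtain ⟨j, ⟨hy, hj⟩ | ⟨hy, hj⟩⟩ := hcases y <;>
      rw [hi, hj, Sym2.eq_iff] at hxy
    · rcases hxy with hxy | hxy
      · have := hval (h.injective hxy.1)
        exact Fin.ext (by omega)
      · have h3 := h.injective hxy.1
        have h4 := h.injective hxy.2
        rw [h3] at h4
        refine absurd ?_ h2
        linear_combination h4
    · rcases hxy with hxy | hxy
      · exact absurd hxy.2.symm (h.ne _ _)
      · exact absurd hxy.1.symm (h.ne _ _)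
    · rcases hxy with hxy | hxy
      · exact absurd hxy.2 (h.ne _ _)
      · exact absurd hxy.2 (h.ne _ _)
    · rcases hxy with hxy | hxy
      · have := hval (add_right_cancel (h.injective hxy.1))
        exact Fin.ext (by omega)
      · exact absurd hxy.1.symm (h.ne _ _)
  · intro x
    obtain ⟨i, ⟨-, hi⟩ | ⟨-, hi⟩⟩ := hcases x <;> rw [hi]
    · exact h.adj_succ i
    · exact h.adj_w _
  · intro x y hne hs
    obtain ⟨i, ⟨hx, hi⟩ | ⟨hx, hi⟩⟩ := hcases x <;> obtain ⟨j, ⟨hy, hj⟩ | ⟨hy, hj⟩⟩ := hcases y <;>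
      rw [hi, hj] at hs <;> rw [hx, hy]
    · rcases h.strongAdj_cycle_cycle hs with rfl | rfl | rfl | rfl
      · exact (hMg.zmod i).1
      · exact (hMg.zmod i).2.1
      · exact (hMg.zmod j).1.symm
      · exact (hMg.zmod j).2.1.symm
    · rcases h.strongAdj_cycle_pendant hs with rfl | rfl | h' | h'
      · exact (hMg.zmod j).2.2.2.2.2.1.symm
      · exact (hMg.zmod i).2.2.2.2.2.2.symm
      · exact hCP i j (Or.inl h')
      · exact hCP i j (Or.inr h')
    · rcases h.strongAdj_cycle_pendant hs.symm with rfl | rfl | h' | h'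
      · exact (hMg.zmod i).2.2.2.2.2.1
      · exact (hMg.zmod j).2.2.2.2.2.2
      · exact (hCP j i (Or.inl h')).symm
      · exact (hCP j i (Or.inr h')).symm
    · rcases h.strongAdj_pendant_pendant hs with rfl | rfl | h'
      · exact (hMg.zmod j).2.2.1.symm
      · exact (hMg.zmod i).2.2.1
      · exact hPP i j h'
  · intro x
    rw [hrange]
    obtain ⟨i, ⟨hx, hi⟩ | ⟨hx, hi⟩⟩ := hcases x <;> rw [hi, hx]
    · have h3 := load_le_sideLoad_add (G := G) (cycleCore v w) (v i) (v (i + 1))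
      have h4 := sideLoad_le (G := G) (K := cycleCore v w) (a := v i) (b := v (i + 1))
        (p := v (i - 1)) (q := w i) fun x hx => by
          have := (h.adj_iff _ _).1 hx
          tauto
      have h5 := sideLoad_le (G := G) (K := cycleCore v w) (a := v (i + 1)) (b := v i)
        (p := v (i + 1 + 1)) (q := w (i + 1)) fun x hx => by
          have := (h.adj_iff _ _).1 hx
          rwa [add_sub_cancel_right] at this
      rw [h.outDegree_v] at h4 h5
      have := hC i
      omega
    · have h3 := load_le_sideLoad_add (G := G) (cycleCore v w) (v (i + 1)) (w (i + 1))
      have h4 := sideLoad_le (G := G) (K := cycleCore v w) (a := v (i + 1)) (b := w (i + 1))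
        (p := v (i + 1 - 1)) (q := v (i + 1 + 1)) fun x hx => by
          have := (h.adj_iff _ _).1 hx
          tauto
      rw [h.outDegree_v, h.outDegree_v] at h4
      have := hP i
      omega
  · rintro e he hek ⟨x, hxe, i, rfl⟩
    rw [hrange] at hek
    obtain ⟨y, rfl⟩ := Sym2.mem_iff_exists.1 hxe
    exact absurd (h.mem_cycleCore he) hek

end IsCubicCycle

end SimpleGraph

namespace SimpleGraph

namespace IsCubicCycle

variable {V : Type u} {G : SimpleGraph V} [Fintype V] {C : Type w} [Nonempty C]
  {L : Sym2 V → Finset C}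

theorem sideLoad_le_six {g : ℕ} {v w : ZMod g → V} (h : G.IsCubicCycle g v w)
    (hG : ∀ v, (G.nbrs v).card ≤ 3) (K : Set (Sym2 V)) (i : ZMod g) :
    G.sideLoad K (w i) (v i) ≤ 6 := by
  classical
  have h1 := sideLoad_le_card_mul hG K (w i) (v i)
  have h2 := card_nbrs_erase_le hG (h.adj_w i).symm
  omega

/-- A cycle of length at least five all of whose outer neighbours are distinct, with adjacent ones
only at opposite places, serves as a core. -/
theorem isStrongColorableAt_of_injective {g : ℕ} {v w : ZMod g → V} (h : G.IsCubicCycle g v w)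
    (hg : 5 ≤ g) (hG : ∀ v, (G.nbrs v).card ≤ 3) (hL : ∀ e ∈ G.edgeSet, 10 ≤ (L e).card)
    (hw : Function.Injective w)
    (hW : ∀ i j : ZMod g, G.Adj (w i) (w j) →
      (g = 5 ∧ (j = i + 2 ∨ i = j + 2)) ∨ (g = 6 ∧ j = i + 3)) :
    G.IsStrongColorableAt L (v 0) := by
  classical
  have : NeZero g := ⟨by omega⟩
  have hmod : ∀ {i j : ℕ} (c : ℕ), j < g → (j : ZMod g) + 1 = (i : ZMod g) + 1 + c →
      j = (i + c) % g := by
    intro i j c hj hij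
    have h1 : ((j : ℕ) : ZMod g) = ((i + c : ℕ) : ZMod g) := by
      push_cast
      linear_combination hij
    rw [ZMod.natCast_eq_natCast_iff', Nat.mod_eq_of_lt hj] at h1
    exact h1
  obtain ⟨M, t, hM, hMg, hMW, ht⟩ := exists_isWheel hg
    (fun i j => G.Adj (w ((i : ZMod g) + 1)) (w ((j : ZMod g) + 1))) (fun i j h => h.symm)
    fun i hi j hj hij => by
      rcases hW _ _ hij with ⟨h5, h' | h'⟩ | ⟨h6, h'⟩
      · have := hmod 2 hj (by exact_mod_cast h')
        subst h5; exact Or.inr (Or.inl ⟨rfl, Or.inl this⟩)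
      · have := hmod 2 hi (by exact_mod_cast h')
        subst h5; exact Or.inr (Or.inl ⟨rfl, Or.inr this⟩)
      · have := hmod 3 hj (by exact_mod_cast h')
        subst h6; exact Or.inr (Or.inr ⟨rfl, this⟩)
  refine h.isStrongColorableAt (by omega) hG hL hM hMg ?_ ?_ ?_ ?_
  · intro i j hij
    rcases hij with hij | hij
    · rw [add_right_cancel (hw hij)]
      exact Or.inl rfl
    · refine hMW _ (ZMod.val_lt i) _ (ZMod.val_lt j) ?_
      simpa using hij
  · intro i j hij
    rcases hij with hij | hij
    · rw [← hw hij]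
      exact (hMg.zmod j).2.2.2.2.1.symm
    · rw [← add_right_cancel (hw hij)]
      exact (hMg.zmod j).2.2.2.1.symm
  · intro i
    have h1 := (ht i.val (ZMod.val_lt i)).2
    have h2 := h.outDegree_w hG i
    have h3 := h.outDegree_w hG (i + 1)
    omega
  · intro i
    have h1 := (ht i.val (ZMod.val_lt i)).1
    -- An outer neighbour that is adjacent to another one raises the exponent, but it also
    -- has an edge of the core.
    set T : Finset V := ((Finset.range g).filter fun j : ℕ =>
      G.Adj (w ((i.val : ZMod g) + 1)) (w ((j : ZMod g) + 1))).image fun j : ℕ =>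
        w ((j : ZMod g) + 1) with hT
    have hTcard : T.card = ((Finset.range g).filter fun j : ℕ =>
        G.Adj (w ((i.val : ZMod g) + 1)) (w ((j : ZMod g) + 1))).card := by
      refine Finset.card_image_of_injOn fun a ha b hb hab => ?_
      have ha' := (Finset.mem_range.1 (Finset.mem_filter.1 (Finset.mem_coe.1 ha)).1)
      have hb' := (Finset.mem_range.1 (Finset.mem_filter.1 (Finset.mem_coe.1 hb)).1)
      have h3 := add_right_cancel (hw hab)
      rwa [ZMod.natCast_eq_natCast_iff', Nat.mod_eq_of_lt ha', Nat.mod_eq_of_lt hb'] at h3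
    have hTsub : T ⊆ (G.nbrs (w (i + 1))).erase (v (i + 1)) := by
      intro y hy
      obtain ⟨j, hj, rfl⟩ := Finset.mem_image.1 hy
      have := (Finset.mem_filter.1 hj).2
      rw [ZMod.natCast_zmod_val] at this
      exact Finset.mem_erase.2 ⟨h.ne _ _, mem_nbrs.2 this⟩
    have hsum : G.sideLoad (cycleCore v w) (w (i + 1)) (v (i + 1)) + T.card ≤ 6 := by
      have h2 := sideLoad_add_le hG (K := cycleCore v w) (h.adj_w (i + 1)).symm hTsub (c := 1)
        fun y hy => by
          obtain ⟨j, -, rfl⟩ := Finset.mem_image.1 hy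
          have := h.outDegree_w hG ((j : ZMod g) + 1)
          omega
      omega
    omega

theorem isStrongColorableAt_triangle {v w : ZMod 3 → V} (h : G.IsCubicCycle 3 v w)
    (hG : ∀ v, (G.nbrs v).card ≤ 3) (hL : ∀ e ∈ G.edgeSet, 10 ≤ (L e).card) :
    G.IsStrongColorableAt L (v 0) := by
  have hC : ∀ i : ZMod 3, hexDigit (ofHexDigits [2, 5, 1, 4, 0, 3]) (2 * i.val + 1) ≤ 5 := by decide
  have hP : ∀ i : ZMod 3, hexDigit (ofHexDigits [2, 5, 1, 4, 0, 3]) (2 * i.val) ≤ 3 := by decide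
  have hPP : ∀ i j : ZMod 3, PairAdj (pairsExcept 6 []) (2 * i.val) (2 * j.val) := by decide
  have hCP : ∀ i j : ZMod 3, PairAdj (pairsExcept 6 []) (2 * i.val + 1) (2 * j.val) := by decide
  refine h.isStrongColorableAt le_rfl hG hL (orientCount_hexDigit_ne_zero isNonzeroConst_triangle)
    (by decide) (fun i j _ => hPP i j) (fun i j _ => hCP i j) (fun i => ?_) fun i => ?_
  · have h2 := h.outDegree_w hG i
    have h3 := h.outDegree_w hG (i + 1)
    have := hC i
    omega
  · have h2 := h.sideLoad_le_six hG (cycleCore v w) (i + 1)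
    have := hP i
    omega

/-- A 4-cycle whose opposite outer neighbours are distinct and not adjacent serves as a core. -/
theorem isStrongColorableAt_square {v w : ZMod 4 → V} (h : G.IsCubicCycle 4 v w)
    (hG : ∀ v, (G.nbrs v).card ≤ 3) (hL : ∀ e ∈ G.edgeSet, 10 ≤ (L e).card)
    (hw : ∀ i, w i ≠ w (i + 2) ∧ ¬ G.Adj (w i) (w (i + 2))) :
    G.IsStrongColorableAt L (v 0) := by
  have hC : ∀ i : ZMod 4, hexDigit (ofHexDigits [3, 4, 3, 2, 3, 5, 3, 3]) (2 * i.val + 1) ≤ 5 := by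
    decide
  have hP : ∀ i : ZMod 4, hexDigit (ofHexDigits [3, 4, 3, 2, 3, 5, 3, 3]) (2 * i.val) ≤ 3 := by
    decide
  have hPP : ∀ i j : ZMod 4, j ≠ i + 2 →
      PairAdj (pairsExcept 8 [(0, 4), (2, 6)]) (2 * i.val) (2 * j.val) := by decide
  have hCP : ∀ i j : ZMod 4,
      PairAdj (pairsExcept 8 [(0, 4), (2, 6)]) (2 * i.val + 1) (2 * j.val) := by decide
  refine h.isStrongColorableAt (by norm_num) hG hL
    (orientCount_hexDigit_ne_zero isNonzeroConst_square)
    (by decide) (fun i j hij => hPP i j ?_) (fun i j _ => hCP i j) (fun i => ?_) fun i => ?_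
  · rintro rfl
    have h1 := hw (i + 1)
    rw [show i + 1 + 2 = i + 2 + 1 by ring] at h1
    exact hij.elim h1.1 h1.2
  · have h2 := h.outDegree_w hG i
    have h3 := h.outDegree_w hG (i + 1)
    have := hC i
    omega
  · have h2 := h.sideLoad_le_six hG (cycleCore v w) (i + 1)
    have := hP i
    omega

/-- A 4-cycle in which two opposite vertices have a third common neighbour serves as a core, if
the other two outer neighbours are distinct and not adjacent. -/
theorem isStrongColorableAt_bipartite {v w : ZMod 4 → V} (h : G.IsCubicCycle 4 v w)
    (hG : ∀ v, (G.nbrs v).card ≤ 3) (hL : ∀ e ∈ G.edgeSet, 10 ≤ (L e).card)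
    (hw : w 0 = w 2) (hw' : w 1 ≠ w 3) (hw'' : ¬ G.Adj (w 1) (w 3)) :
    G.IsStrongColorableAt L (v 0) := by
  have hC : ∀ i : ZMod 4, hexDigit (ofHexDigits [3, 6, 2, 4, 3, 5, 3, 1]) (2 * i.val + 1) ≤ 6 := by
    decide
  have hP : ∀ i : ZMod 4, hexDigit (ofHexDigits [3, 6, 2, 4, 3, 5, 3, 1]) (2 * i.val) ≤ 3 := by
    decide
  have hPP : ∀ i j : ZMod 4, ¬ (i = 0 ∧ j = 2) → ¬ (i = 2 ∧ j = 0) →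
      PairAdj (pairsExcept 8 [(0, 4)]) (2 * i.val) (2 * j.val) := by decide
  have hCP : ∀ i j : ZMod 4,
      PairAdj (pairsExcept 8 [(0, 4)]) (2 * i.val + 1) (2 * j.val) := by decide
  have h02 : G.outDegree (cycleCore v w) (w 0) ≤ 1 :=
    outDegree_le_one hG (h.injective.ne (by decide : (0 : ZMod 4) ≠ 2)) (h.adj_w 0).symm
      (by rw [Sym2.eq_swap]; exact h.mem_cycleCore (h.adj_w 0)) (by rw [hw]; exact (h.adj_w 2).symm)
      (by rw [hw, Sym2.eq_swap]; exact h.mem_cycleCore (h.adj_w 2))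
  refine h.isStrongColorableAt (by norm_num) hG hL
    (orientCount_hexDigit_ne_zero isNonzeroConst_bipartite)
    (by decide) (fun i j hij => hPP i j ?_ ?_) (fun i j _ => hCP i j) (fun i => ?_) fun i => ?_
  · rintro ⟨rfl, rfl⟩
    exact hij.elim hw' hw''
  · rintro ⟨rfl, rfl⟩
    exact hij.elim hw'.symm fun h => hw'' h.symm
  · have h2 : G.outDegree (cycleCore v w) (w i) + G.outDegree (cycleCore v w) (w (i + 1)) ≤ 3 := by
      have h3 := h.outDegree_w hG 1
      have h4 := h.outDegree_w hG 3
      have h5 : G.outDegree (cycleCore v w) (w 2) ≤ 1 := hw ▸ h02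
      have hi : i = 0 ∨ i = 1 ∨ i = 2 ∨ i = 3 := by revert i; decide
      rcases hi with rfl | rfl | rfl | rfl
      · rw [zero_add]; omega
      · rw [show (1 + 1 : ZMod 4) = 2 by decide]; omega
      · rw [show (2 + 1 : ZMod 4) = 3 by decide]; omega
      · rw [show (3 + 1 : ZMod 4) = 0 by decide]; omega
    have := hC i
    omega
  · have h2 := h.sideLoad_le_six hG (cycleCore v w) (i + 1)
    have := hP i
    omega

/-- A pentagon in which two vertices at distance two have a common outer neighbour serves as a
core, if this neighbour and the other three outer neighbours are distinct, where only the outer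
neighbour between the two vertices may be adjacent to those at the opposite edge. -/
theorem isStrongColorableAt_squarePentagon {v w : ZMod 5 → V} (h : G.IsCubicCycle 5 v w)
    (hG : ∀ v, (G.nbrs v).card ≤ 3) (hL : ∀ e ∈ G.edgeSet, 10 ≤ (L e).card)
    (h02 : w 0 = w 2) (h13 : w 1 ≠ w 3) (h14 : w 1 ≠ w 4) (h03 : w 0 ≠ w 3) (h04 : w 0 ≠ w 4)
    (h34 : w 3 ≠ w 4) (h03' : ¬ G.Adj (w 0) (w 3)) (h04' : ¬ G.Adj (w 0) (w 4)) :
    G.IsStrongColorableAt L (v 0) := by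
  classical
  obtain ⟨M, t, hM, hMX, hp, hq, ht0, ht1, ht2, ht3, ht4, ht5, ht6, ht7, ht8, ht9⟩ :=
    exists_squarePentagon (G.Adj (w 1) (w 4)) (G.Adj (w 1) (w 3))
  have hval : ∀ i : ZMod 5, i = 0 ∨ i = 1 ∨ i = 2 ∨ i = 3 ∨ i = 4 := by decide
  have hPP : ∀ i j : ZMod 5, ¬ (i = 0 ∧ j = 2) → ¬ (i = 0 ∧ j = 3) → ¬ (i = 1 ∧ j = 3) →
      ¬ (i = 2 ∧ j = 4) → ¬ (j = 0 ∧ i = 2) → ¬ (j = 0 ∧ i = 3) → ¬ (j = 1 ∧ i = 3) →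
      ¬ (j = 2 ∧ i = 4) →
        PairAdj (selectPairs squarePentagonPairs squarePentagonChords [])
          (2 * i.val) (2 * j.val) := by
    decide +kernel
  have hCP : ∀ i j : ZMod 5, ¬ (i = 3 ∧ j = 0) → ¬ (i = 1 ∧ j = 3) → ¬ (i = 0 ∧ j = 2) →
      PairAdj (selectPairs squarePentagonPairs squarePentagonChords [])
        (2 * i.val + 1) (2 * j.val) := by decide +kernel
  have hmono : ∀ {a b}, PairAdj (selectPairs squarePentagonPairs squarePentagonChords []) a b →
      PairAdj M a b := fun h => h.imp_right fun h => h.imp (fun h => hMX h) fun h => hMX h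
  have e1 : (0 + 1 : ZMod 5) = 1 := by decide
  have e2 : (1 + 1 : ZMod 5) = 2 := by decide
  have e3 : (2 + 1 : ZMod 5) = 3 := by decide
  have e4 : (3 + 1 : ZMod 5) = 4 := by decide
  have e5 : (4 + 1 : ZMod 5) = 0 := by decide
  have ho : G.outDegree (cycleCore v w) (w 0) ≤ 1 :=
    outDegree_le_one hG (h.injective.ne (by decide : (0 : ZMod 5) ≠ 2)) (h.adj_w 0).symm
      (by rw [Sym2.eq_swap]; exact h.mem_cycleCore (h.adj_w 0))
      (by rw [h02]; exact (h.adj_w 2).symm)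
      (by rw [h02, Sym2.eq_swap]; exact h.mem_cycleCore (h.adj_w 2))
  have ho2 : G.outDegree (cycleCore v w) (w 2) ≤ 1 := h02 ▸ ho
  refine h.isStrongColorableAt (by norm_num) hG hL hM
    (IsWheel.mono (by decide +kernel) hMX) ?_ ?_ ?_ ?_
  · have key : ∀ i j : ZMod 5, (i = 0 ∧ j = 2) ∨ (i = 0 ∧ j = 3) ∨ (i = 1 ∧ j = 3) ∨
        (i = 2 ∧ j = 4) → (w (i + 1) = w (j + 1) ∨ G.Adj (w (i + 1)) (w (j + 1))) →
        PairAdj M (2 * i.val) (2 * j.val) := by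
      rintro i j (⟨rfl, rfl⟩ | ⟨rfl, rfl⟩ | ⟨rfl, rfl⟩ | ⟨rfl, rfl⟩)
      · rw [e1, e3]
        exact fun h => h.elim (fun h => absurd h h13) fun h => Or.inr (Or.inl (hq h))
      · rw [e1, e4]
        exact fun h => h.elim (fun h => absurd h h14) fun h => Or.inr (Or.inl (hp h))
      · rw [e2, e4, ← h02]
        exact fun h => h.elim (fun h => absurd h h04) fun h => absurd h h04'
      · rw [e3, e5]
        exact fun h => h.elim (fun h => absurd h.symm h03) fun h => absurd h.symm h03'
    intro i j hij
    by_cases h1 : (i = 0 ∧ j = 2) ∨ (i = 0 ∧ j = 3) ∨ (i = 1 ∧ j = 3) ∨ (i = 2 ∧ j = 4)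
    · exact key i j h1 hij
    by_cases h2 : (j = 0 ∧ i = 2) ∨ (j = 0 ∧ i = 3) ∨ (j = 1 ∧ i = 3) ∨ (j = 2 ∧ i = 4)
    · exact (key j i h2 (hij.imp Eq.symm fun h => h.symm)).symm
    simp only [not_or] at h1 h2
    exact hmono (hPP i j h1.1 h1.2.1 h1.2.2.1 h1.2.2.2 h2.1 h2.2.1 h2.2.2.1 h2.2.2.2)
  · intro i j hij
    refine hmono (hCP i j ?_ ?_ ?_)
    · rintro ⟨rfl, rfl⟩
      rw [e1, e4] at hij
      exact hij.elim h13 h14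
    · rintro ⟨rfl, rfl⟩
      rw [e2, e4, ← h02] at hij
      exact hij.elim h14.symm h04.symm
    · rintro ⟨rfl, rfl⟩
      rw [e1, e3] at hij
      exact hij.elim h03.symm h13.symm
  · intro i
    have h1 := h.outDegree_w hG 1
    have h3 := h.outDegree_w hG 3
    have h4 := h.outDegree_w hG 4
    rcases hval i with rfl | rfl | rfl | rfl | rfl
    · rw [e1]; change _ + t 1 ≤ 9; omega
    · rw [e2]; change _ + t 3 ≤ 9; omega
    · rw [e3]; change _ + t 5 ≤ 9; omega
    · rw [e4]; change _ + t 7 ≤ 9; omega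
    · rw [e5]; change _ + t 9 ≤ 9; omega
  · have hs := h.sideLoad_le_six hG (cycleCore v w)
    intro i
    rcases hval i with rfl | rfl | rfl | rfl | rfl
    · rw [e1]
      change _ + t 0 ≤ 9
      set T : Finset V := (if G.Adj (w 1) (w 4) then {w 4} else ∅) ∪
        (if G.Adj (w 1) (w 3) then {w 3} else ∅) with hT
      have hTmem : ∀ y ∈ T, (y = w 4 ∨ y = w 3) ∧ G.Adj (w 1) y := by
        intro y hy
        rw [hT, Finset.mem_union] at hy
        rcases hy with hy | hy <;> split_ifs at hy with h'
        · rw [Finset.mem_singleton.1 hy]; exact ⟨Or.inl rfl, h'⟩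
        · simp at hy
        · rw [Finset.mem_singleton.1 hy]; exact ⟨Or.inr rfl, h'⟩
        · simp at hy
      have hTcard : T.card = (if G.Adj (w 1) (w 4) then 1 else 0) +
          (if G.Adj (w 1) (w 3) then 1 else 0) := by
        rw [hT, Finset.card_union_of_disjoint]
        · split_ifs <;> simp
        · split_ifs <;> simp [h34.symm]
      have h2 := sideLoad_add_le hG (K := cycleCore v w) (h.adj_w 1).symm (T := T) (c := 1)
        (fun y hy => by
          obtain ⟨hy1, hy2⟩ := hTmem y hy
          refine Finset.mem_erase.2 ⟨?_, mem_nbrs.2 hy2⟩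
          rcases hy1 with rfl | rfl <;> exact h.ne _ _)
        fun y hy => by
          obtain ⟨rfl | rfl, -⟩ := hTmem y hy
          · have := h.outDegree_w hG 4
            omega
          · have := h.outDegree_w hG 3
            omega
      omega
    · rw [e2]
      change _ + t 2 ≤ 9
      have h2 := sideLoad_add_le hG (K := cycleCore v w) (h.adj_w 2).symm (T := {v 0}) (c := 3)
        (by
          rw [Finset.singleton_subset_iff, Finset.mem_erase, mem_nbrs, ← h02]
          exact ⟨h.injective.ne (by decide), (h.adj_w 0).symm⟩)
        (by
          intro y hy
          rw [Finset.mem_singleton.1 hy, h.outDegree_v])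
      rw [Finset.card_singleton] at h2
      omega
    · rw [e3]
      change _ + t 4 ≤ 9
      have := hs 3
      omega
    · rw [e4]
      change _ + t 6 ≤ 9
      have := hs 4
      omega
    · rw [e5]
      change _ + t 8 ≤ 9
      have := hs 0
      omega

end IsCubicCycle

end SimpleGraph

namespace SimpleGraph

variable {V : Type u} {G : SimpleGraph V}

/-! ### Dominoes -/

/-- `b`, `c` and `d` are the neighbours of `a`, and they are distinct. -/
structure HasNbrs (G : SimpleGraph V) (a b c d : V) : Prop where
  adj_iff : ∀ x, G.Adj a x ↔ x = b ∨ x = c ∨ x = d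
  ne₁ : b ≠ c
  ne₂ : b ≠ d
  ne₃ : c ≠ d

theorem HasNbrs.rotate {a b c d : V} (h : G.HasNbrs a b c d) : G.HasNbrs a c d b :=
  ⟨fun x => by rw [h.adj_iff]; tauto, h.ne₃, h.ne₁.symm, h.ne₂.symm⟩

theorem HasNbrs.swap {a b c d : V} (h : G.HasNbrs a b c d) : G.HasNbrs a c b d :=
  ⟨fun x => by rw [h.adj_iff]; tauto, h.ne₁.symm, h.ne₃, h.ne₂⟩

theorem IsStrongColorableAt.of_reachable {C : Type w} {L : Sym2 V → Finset C} {a b : V}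
    (h : G.IsStrongColorableAt L a) (hab : G.Reachable a b) : G.IsStrongColorableAt L b := by
  obtain ⟨φ, hφ⟩ := h
  have key : ∀ {e : Sym2 V}, (∃ x ∈ e, G.Reachable b x) → ∃ x ∈ e, G.Reachable a x :=
    fun ⟨x, hx, hbx⟩ => ⟨x, hx, hab.trans hbx⟩
  refine ⟨φ, fun e he heb => ⟨(hφ e he (key heb)).1, fun f hf hfb => ?_⟩⟩
  exact (hφ e he (key heb)).2 f hf (key hfb)

/-- Two 4-cycles `v₁ v₂ v₃ v₄` and `v₁ v₂ w₂ w₁` that share the edge `v₁ v₂` only; `y₃`, `y₄`, `z₁`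
and `z₂` are the remaining neighbours of `v₃`, `v₄`, `w₁` and `w₂`. -/
structure IsDomino (G : SimpleGraph V) (v₁ v₂ v₃ v₄ w₁ w₂ y₃ y₄ z₁ z₂ : V) : Prop where
  nodup : [v₁, v₂, v₃, v₄, w₁, w₂].Nodup
  nbrs_v₁ : G.HasNbrs v₁ v₂ v₄ w₁
  nbrs_v₂ : G.HasNbrs v₂ v₁ v₃ w₂
  nbrs_v₃ : G.HasNbrs v₃ v₂ v₄ y₃
  nbrs_v₄ : G.HasNbrs v₄ v₃ v₁ y₄
  nbrs_w₁ : G.HasNbrs w₁ v₁ w₂ z₁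
  nbrs_w₂ : G.HasNbrs w₂ v₂ w₁ z₂

variable [Fintype V] {C : Type w} [Nonempty C] {L : Sym2 V → Finset C}

theorem HasNbrs.sideLoad_le₁ {a b c d : V} (h : G.HasNbrs a b c d) (K : Set (Sym2 V)) :
    G.sideLoad K a b ≤ G.outDegree K c + G.outDegree K d :=
  SimpleGraph.sideLoad_le fun x hx => (h.adj_iff x).1 hx

theorem HasNbrs.sideLoad_le₂ {a b c d : V} (h : G.HasNbrs a b c d) (K : Set (Sym2 V)) :
    G.sideLoad K a c ≤ G.outDegree K b + G.outDegree K d :=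
  SimpleGraph.sideLoad_le fun x hx => by have := (h.adj_iff x).1 hx; tauto

theorem HasNbrs.sideLoad_le₃ {a b c d : V} (h : G.HasNbrs a b c d) (K : Set (Sym2 V)) :
    G.sideLoad K a d ≤ G.outDegree K b + G.outDegree K c :=
  SimpleGraph.sideLoad_le fun x hx => by have := (h.adj_iff x).1 hx; tauto

theorem HasNbrs.outDegree_le_one {a b c d : V} (h : G.HasNbrs a b c d)
    (hG : ∀ v, (G.nbrs v).card ≤ 3) {K : Set (Sym2 V)} (hb : s(a, b) ∈ K) (hc : s(a, c) ∈ K) :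
    G.outDegree K a ≤ 1 :=
  SimpleGraph.outDegree_le_one hG h.ne₁ ((h.adj_iff _).2 (by simp)) hb
    ((h.adj_iff _).2 (by simp)) hc

theorem HasNbrs.outDegree_eq_zero {a b c d : V} (h : G.HasNbrs a b c d)
    {K : Set (Sym2 V)} (hb : s(a, b) ∈ K) (hc : s(a, c) ∈ K) (hd : s(a, d) ∈ K) :
    G.outDegree K a = 0 :=
  SimpleGraph.outDegree_eq_zero fun z hz => by
    rcases (h.adj_iff z).1 hz with rfl | rfl | rfl <;> assumption

/-- An edge outside the core at a vertex whose other two edges are in the core. -/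
theorem HasNbrs.load_le {a b c d y : V} (h : G.HasNbrs a b c d)
    (hG : ∀ v, (G.nbrs v).card ≤ 3) {K : Set (Sym2 V)} (hb : s(a, b) ∈ K) (hc : s(a, c) ∈ K)
    (hbc : G.outDegree K b + G.outDegree K c ≤ 3) (hy : G.Adj a y) (hyK : s(a, y) ∉ K) :
    G.load K s(a, y) ≤ 9 := by
  classical
  rcases (h.adj_iff y).1 hy with rfl | rfl | rfl
  · exact absurd hb hyK
  · exact absurd hc hyK
  · have h1 := load_le_sideLoad_add (G := G) K a y
    have h2 := h.sideLoad_le₃ K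
    have h3 := sideLoad_le_card_mul hG K y a
    have h4 := card_nbrs_erase_le hG hy.symm
    omega

namespace IsDomino

/-- A domino serves as a core if the edges `v₃ v₄` and `w₁ w₂` are not in conflict, or if they are
joined by the edge `v₃ w₁`. The core consists of the edges at `v₁` and `v₂` and these two edges. In
the second case it is a clique of conflicts, but the edge `v₃ w₁` makes some lists longer. -/
theorem isStrongColorableAt_of_not_strongAdj_or_eq {v₁ v₂ v₃ v₄ w₁ w₂ y₃ y₄ z₁ z₂ : V}
    (h : G.IsDomino v₁ v₂ v₃ v₄ w₁ w₂ y₃ y₄ z₁ z₂)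
    (hG : ∀ v, (G.nbrs v).card ≤ 3) (hL : ∀ e ∈ G.edgeSet, 10 ≤ (L e).card)
    (hc : ¬ G.StrongAdj s(v₃, v₄) s(w₁, w₂) ∨ y₃ = w₁) : G.IsStrongColorableAt L v₁ := by
  obtain ⟨hnd, h1, h2, h3, h4, h5, h6⟩ := h
  set κ : Fin 7 → Sym2 V := ![s(v₁, v₂), s(v₂, v₃), s(v₄, v₁), s(v₁, w₁), s(v₂, w₂), s(v₃, v₄),
    s(w₁, w₂)] with hκ
  simp only [List.nodup_cons, List.mem_cons, List.not_mem_nil, or_false, not_or, not_false_eq_true,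
    List.nodup_nil, and_true] at hnd
  obtain ⟨⟨n12, n13, n14, n15, n16⟩, ⟨n23, n24, n25, n26⟩, ⟨n34, n35, n36⟩, ⟨n45, n46⟩, n56⟩ := hnd
  have hinj : Function.Injective κ := by
    have : (List.ofFn κ).Nodup := by
      simp [List.ofFn_succ, *, Ne.symm, eq_comm]
    exact List.nodup_ofFn.1 this
  set K := Set.range κ with hK
  have k1 : s(v₁, v₂) ∈ K := ⟨0, rfl⟩
  have k2 : s(v₂, v₃) ∈ K := ⟨1, rfl⟩
  have k3 : s(v₄, v₁) ∈ K := ⟨2, rfl⟩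
  have k4 : s(v₁, w₁) ∈ K := ⟨3, rfl⟩
  have k5 : s(v₂, w₂) ∈ K := ⟨4, rfl⟩
  have k6 : s(v₃, v₄) ∈ K := ⟨5, rfl⟩
  have k7 : s(w₁, w₂) ∈ K := ⟨6, rfl⟩
  have k1' := k1; have k2' := k2; have k3' := k3; have k4' := k4; have k5' := k5
  have k6' := k6; have k7' := k7
  rw [Sym2.eq_swap] at k1' k2' k3' k4' k5' k6' k7'
  have o1 := h1.outDegree_eq_zero k1 k3' k4
  have o2 := h2.outDegree_eq_zero k1' k2 k5
  have o3 := h3.outDegree_le_one hG k2' k6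
  have o4 := h4.outDegree_le_one hG k6' k3
  have o5 := h5.outDegree_le_one hG k4' k7
  have o6 := h6.outDegree_le_one hG k5' k7'
  have oy3 := outDegree_le_three hG K y₃
  have oy4 := outDegree_le_three hG K y₄
  have oz1 := outDegree_le_three hG K z₁
  have oz2 := outDegree_le_three hG K z₂
  have l1 := (load_le_sideLoad_add K v₁ v₂).trans
    (Nat.add_le_add (h1.sideLoad_le₁ K) (h2.sideLoad_le₁ K))
  have l2 := (load_le_sideLoad_add K v₂ v₃).trans
    (Nat.add_le_add (h2.sideLoad_le₂ K) (h3.sideLoad_le₁ K))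
  have l3 := (load_le_sideLoad_add K v₄ v₁).trans
    (Nat.add_le_add (h4.sideLoad_le₂ K) (h1.sideLoad_le₂ K))
  have l4 := (load_le_sideLoad_add K v₁ w₁).trans
    (Nat.add_le_add (h1.sideLoad_le₃ K) (h5.sideLoad_le₁ K))
  have l5 := (load_le_sideLoad_add K v₂ w₂).trans
    (Nat.add_le_add (h2.sideLoad_le₃ K) (h6.sideLoad_le₁ K))
  have l6 := (load_le_sideLoad_add K v₃ v₄).trans
    (Nat.add_le_add (h3.sideLoad_le₂ K) (h4.sideLoad_le₁ K))
  have l7 := (load_le_sideLoad_add K w₁ w₂).trans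
    (Nat.add_le_add (h5.sideLoad_le₂ K) (h6.sideLoad_le₂ K))
  have hE : ∀ i, κ i ∈ G.edgeSet := by
    have a1 : G.Adj v₁ v₂ := (h1.adj_iff _).2 (by simp)
    have a2 : G.Adj v₂ v₃ := (h2.adj_iff _).2 (by simp)
    have a3 : G.Adj v₄ v₁ := (h4.adj_iff _).2 (by simp)
    have a4 : G.Adj v₁ w₁ := (h1.adj_iff _).2 (by simp)
    have a5 : G.Adj v₂ w₂ := (h2.adj_iff _).2 (by simp)
    have a6 : G.Adj v₃ v₄ := (h3.adj_iff _).2 (by simp)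
    have a7 : G.Adj w₁ w₂ := (h5.adj_iff _).2 (by simp)
    intro i
    fin_cases i <;> assumption
  have hS : ∀ e ∈ G.edgeSet, e ∉ K → (∃ x ∈ e, x ∈ ({v₁, v₂, v₃, v₄, w₁, w₂} : Set V)) →
      G.load K e ≤ 9 := by
    rintro e he hek ⟨x, hxe, hx⟩
    obtain ⟨y, rfl⟩ := Sym2.mem_iff_exists.1 hxe
    rcases hx with rfl | rfl | rfl | rfl | rfl | rfl
    · exact h1.load_le hG k1 k3' (by omega) he hek
    · exact h2.load_le hG k1' k2 (by omega) he hek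
    · exact h3.load_le hG k2' k6 (by omega) he hek
    · exact h4.load_le hG k6' k3 (by omega) he hek
    · exact h5.load_le hG k4' k7 (by omega) he hek
    · exact h6.load_le hG k5' k7' (by omega) he hek
  rcases hc with hc | rfl
  · have hM : ∀ i j : Fin 7, ¬ (i = 5 ∧ j = 6) → ¬ (i = 6 ∧ j = 5) →
        PairAdj (pairsExcept 7 [(5, 6)]) i j := by decide
    refine isStrongColorableAt_of_core hG hL {v₁, v₂, v₃, v₄, w₁, w₂} κ hinj hE
      (orientCount_hexDigit_ne_zero isNonzeroConst_domino) (fun i j _ hs => hM i j ?_ ?_)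
      ?_ hS (by simp)
    · rintro ⟨rfl, rfl⟩
      exact hc hs
    · rintro ⟨rfl, rfl⟩
      exact hc hs.symm
    · intro i
      fin_cases i
      · change G.load K s(v₁, v₂) + 5 ≤ 9
        omega
      · change G.load K s(v₂, v₃) + 0 ≤ 9
        omega
      · change G.load K s(v₄, v₁) + 4 ≤ 9
        omega
      · change G.load K s(v₁, w₁) + 3 ≤ 9
        omega
      · change G.load K s(v₂, w₂) + 2 ≤ 9
        omega
      · change G.load K s(v₃, v₄) + 3 ≤ 9
        omega
      · change G.load K s(w₁, w₂) + 3 ≤ 9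
        omega
  · have hM : ∀ i j : Fin 7, PairAdj (pairsExcept 7 []) i j := by decide
    obtain rfl : v₃ = z₁ := by
      have : G.Adj v₃ y₃ := (h3.adj_iff _).2 (by simp)
      rcases (h5.adj_iff _).1 this.symm with h | h | h
      · exact absurd h.symm n13
      · exact absurd h n36
      · exact h
    refine isStrongColorableAt_of_core hG hL {v₁, v₂, v₃, v₄, y₃, w₂} κ hinj hE
      (orientCount_hexDigit_ne_zero isNonzeroConst_complete_seven) (fun i j _ _ => hM i j)
      ?_ hS (by simp)
    intro i
    fin_cases i
    · change G.load K s(v₁, v₂) + 4 ≤ 9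
      omega
    · change G.load K s(v₂, v₃) + 6 ≤ 9
      omega
    · change G.load K s(v₄, v₁) + 3 ≤ 9
      omega
    · change G.load K s(v₁, y₃) + 5 ≤ 9
      omega
    · change G.load K s(v₂, w₂) + 2 ≤ 9
      omega
    · change G.load K s(v₃, v₄) + 1 ≤ 9
      omega
    · change G.load K s(y₃, w₂) + 0 ≤ 9
      omega

/-- A domino serves as a core if the edges `v₄ w₁` and `v₃ w₂`, which would form triangles, are
absent. -/
theorem isStrongColorableAt {v₁ v₂ v₃ v₄ w₁ w₂ y₃ y₄ z₁ z₂ : V}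
    (h : G.IsDomino v₁ v₂ v₃ v₄ w₁ w₂ y₃ y₄ z₁ z₂)
    (hG : ∀ v, (G.nbrs v).card ≤ 3) (hL : ∀ e ∈ G.edgeSet, 10 ≤ (L e).card)
    (h₁ : ¬ G.Adj v₄ w₁) (h₂ : ¬ G.Adj v₃ w₂) : G.IsStrongColorableAt L v₁ := by
  have hnd := h.nodup
  simp only [List.nodup_cons, List.mem_cons, List.not_mem_nil, or_false, not_or, not_false_eq_true,
    List.nodup_nil, and_true] at hnd
  by_cases hs : G.StrongAdj s(v₃, v₄) s(w₁, w₂)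
  swap
  · exact h.isStrongColorableAt_of_not_strongAdj_or_eq hG hL (Or.inl hs)
  obtain ⟨-, x, hx, y, hy, hxy⟩ := hs
  have hadj : G.Adj v₃ w₁ ∨ G.Adj v₄ w₂ := by
    rcases Sym2.mem_iff.1 hx with rfl | rfl <;> rcases Sym2.mem_iff.1 hy with rfl | rfl <;> tauto
  rcases hadj with hadj | hadj
  · refine h.isStrongColorableAt_of_not_strongAdj_or_eq hG hL (Or.inr ?_)
    rcases (h.nbrs_v₃.adj_iff _).1 hadj with h' | h' | h'
    · exact absurd h'.symm (by tauto)
    · exact absurd h'.symm (by tauto)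
    · exact h'.symm
  · have hflip : G.IsDomino v₂ v₁ v₄ v₃ w₂ w₁ y₄ y₃ z₂ z₁ := by
      refine ⟨?_, h.nbrs_v₂, h.nbrs_v₁, h.nbrs_v₄.swap, h.nbrs_v₃.swap, h.nbrs_w₂, h.nbrs_w₁⟩
      simp only [List.nodup_cons, List.mem_cons, List.not_mem_nil, or_false, not_or,
        not_false_eq_true, List.nodup_nil, and_true]
      tauto
    refine (hflip.isStrongColorableAt_of_not_strongAdj_or_eq hG hL (Or.inr ?_)).of_reachable
      ((h.nbrs_v₂.adj_iff _).2 (Or.inl rfl)).reachable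
    rcases (h.nbrs_v₄.adj_iff _).1 hadj with h' | h' | h'
    · exact absurd h'.symm (by tauto)
    · exact absurd h'.symm (by tauto)
    · exact h'.symm

end IsDomino

end SimpleGraph

namespace SimpleGraph

variable {V : Type u} {G : SimpleGraph V}

/-! ### Triangles and 4-cycles -/

theorem not_isStrongColorableAt_of_adj {C : Type w} {L : Sym2 V → Finset C} {a b : V}
    (h : ¬ G.IsStrongColorableAt L a) (hab : G.Adj a b) : ¬ G.IsStrongColorableAt L b :=
  fun hb => h (hb.of_reachable hab.symm.reachable)

theorem IsCubicCycle.rotate {g : ℕ} {v w : ZMod g → V} (h : G.IsCubicCycle g v w) (k : ZMod g) :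
    G.IsCubicCycle g (fun i => v (i + k)) fun i => w (i + k) := by
  refine ⟨fun i j hij => add_right_cancel (h.injective hij), fun i x => ?_, fun i j => h.ne _ _⟩
  rw [h.adj_iff, show i + k - 1 = i - 1 + k by ring, show i + k + 1 = i + 1 + k by ring]

variable [Fintype V]

theorem exists_hasNbrs {a b c : V} (ha : (G.nbrs a).card = 3) (hb : G.Adj a b) (hc : G.Adj a c)
    (hbc : b ≠ c) : ∃ d, G.HasNbrs a b c d := by
  classical
  obtain ⟨d, hd⟩ : ∃ d, ((G.nbrs a).erase b).erase c = {d} := by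
    rw [← Finset.card_eq_one, Finset.card_erase_of_mem, Finset.card_erase_of_mem, ha]
    · exact mem_nbrs.2 hb
    · exact Finset.mem_erase.2 ⟨hbc.symm, mem_nbrs.2 hc⟩
  have key : ∀ x, (x ≠ c ∧ x ≠ b ∧ G.Adj a x) ↔ x = d := by
    intro x
    rw [← Finset.mem_singleton, ← hd, Finset.mem_erase, Finset.mem_erase, mem_nbrs]
  have hd' := (key d).2 rfl
  refine ⟨d, fun x => ⟨fun hx => ?_, ?_⟩, hbc, hd'.2.1.symm, hd'.1.symm⟩
  · have := key x
    tauto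
  · rintro (rfl | rfl | rfl)
    · exact hb
    · exact hc
    · exact hd'.2.2

theorem exists_hasNbrs_of_adj {a b : V} (ha : (G.nbrs a).card = 3) (hb : G.Adj a b) :
    ∃ c d, G.HasNbrs a b c d := by
  classical
  obtain ⟨c, hc⟩ : ((G.nbrs a).erase b).Nonempty := by
    rw [← Finset.card_pos, Finset.card_erase_of_mem (mem_nbrs.2 hb)]
    omega
  obtain ⟨hcb, hc⟩ := Finset.mem_erase.1 hc
  exact ⟨c, exists_hasNbrs ha hb (mem_nbrs.1 hc) hcb.symm⟩

variable {C : Type w} [Nonempty C] {L : Sym2 V → Finset C}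

theorem card_nbrs_eq_three (hG : ∀ v, (G.nbrs v).card ≤ 3)
    (hL : ∀ e ∈ G.edgeSet, 10 ≤ (L e).card) {a : V} (ha : ¬ G.IsStrongColorableAt L a) :
    (G.nbrs a).card = 3 := by
  have h1 := hG a
  have h2 : ¬ (G.nbrs a).card ≤ 2 :=
    fun h => ha (isStrongColorableAt_of_card_nbrs_le_two hG hL h)
  omega

/-- In an uncolourable component, all vertices have degree three, so a cycle without chords has
outer neighbours. -/
theorem exists_isCubicCycle (hG : ∀ v, (G.nbrs v).card ≤ 3)
    (hL : ∀ e ∈ G.edgeSet, 10 ≤ (L e).card) {g : ℕ} (hg : 3 ≤ g) {v : ZMod g → V}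
    (hv : Function.Injective v) (hadj : ∀ i, G.Adj (v i) (v (i + 1)))
    (hchord : ∀ i j, G.Adj (v i) (v j) → j = i + 1 ∨ i = j + 1)
    (hb : ∀ i, ¬ G.IsStrongColorableAt L (v i)) : ∃ w, G.IsCubicCycle g v w := by
  have h2 : (2 : ZMod g) ≠ 0 := by
    intro h0
    have := (ZMod.natCast_eq_zero_iff 2 g).1 (by exact_mod_cast h0)
    exact absurd (Nat.le_of_dvd (by norm_num) this) (by omega)
  have hadj' : ∀ i, G.Adj (v i) (v (i - 1)) := fun i => by
    have := hadj (i - 1)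
    rw [sub_add_cancel] at this
    exact this.symm
  have hex : ∀ i, ∃ d, G.HasNbrs (v i) (v (i - 1)) (v (i + 1)) d := fun i =>
    exists_hasNbrs (card_nbrs_eq_three hG hL (hb i)) (hadj' i) (hadj i) fun h => by
      refine h2 ?_
      linear_combination -hv h
  choose w hw using hex
  refine ⟨w, hv, fun i => (hw i).adj_iff, fun i j hij => ?_⟩
  have h : G.Adj (v i) (v j) := ((hw i).adj_iff _).2 (Or.inr (Or.inr hij.symm))
  rcases hchord i j h with rfl | rfl
  · exact (hw i).ne₃ hij.symm
  · exact (hw (j + 1)).ne₂ (by rw [hij, add_sub_cancel_right])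

/-- An uncolourable component has no triangle. -/
theorem not_adj_of_adj_of_adj (hG : ∀ v, (G.nbrs v).card ≤ 3)
    (hL : ∀ e ∈ G.edgeSet, 10 ≤ (L e).card) {a b c : V} (ha : ¬ G.IsStrongColorableAt L a)
    (hab : G.Adj a b) (hbc : G.Adj b c) : ¬ G.Adj a c := by
  intro hac
  have h3 : ∀ i j : ZMod 3, i = j ∨ j = i + 1 ∨ i = j + 1 := by decide
  set v : ZMod 3 → V := (![a, b, c] : Fin 3 → V) with hv
  have hadj : ∀ i, G.Adj (v i) (v (i + 1)) := by
    intro i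
    fin_cases i
    · exact hab
    · exact hbc
    · exact hac.symm
  obtain ⟨w, hw⟩ := exists_isCubicCycle hG hL (le_refl 3) (v := v)
    (fun i j hij => by
      rcases h3 i j with h | rfl | rfl
      · exact h
      · exact absurd hij (hadj i).ne
      · exact absurd hij.symm (hadj j).ne)
    hadj
    (fun i j hij => by
      rcases h3 i j with rfl | h
      · exact absurd rfl hij.ne
      · exact h)
    (fun i => by
      fin_cases i
      · exact ha
      · exact not_isStrongColorableAt_of_adj ha hab
      · exact not_isStrongColorableAt_of_adj ha hac)
  exact ha (hw.isStrongColorableAt_triangle hG hL)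

/-- Every 4-cycle of an uncolourable component is chordless. -/
theorem exists_isCubicCycle_four (hG : ∀ v, (G.nbrs v).card ≤ 3)
    (hL : ∀ e ∈ G.edgeSet, 10 ≤ (L e).card) {a b c d : V} (ha : ¬ G.IsStrongColorableAt L a)
    (hab : G.Adj a b) (hbc : G.Adj b c) (hcd : G.Adj c d) (hda : G.Adj d a) (hac : a ≠ c)
    (hbd : b ≠ d) : ∃ w, G.IsCubicCycle 4 (![a, b, c, d] : Fin 4 → V) w := by
  have hb := not_isStrongColorableAt_of_adj ha hab
  have hc := not_isStrongColorableAt_of_adj hb hbc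
  have hd := not_isStrongColorableAt_of_adj ha hda.symm
  have h4 : ∀ i j : ZMod 4, i = j ∨ j = i + 1 ∨ i = j + 1 ∨ j = i + 2 := by decide
  set v : ZMod 4 → V := (![a, b, c, d] : Fin 4 → V) with hv
  have hadj : ∀ i, G.Adj (v i) (v (i + 1)) := by
    intro i
    fin_cases i
    · exact hab
    · exact hbc
    · exact hcd
    · exact hda
  have hopp : ∀ i, v i ≠ v (i + 2) := by
    intro i
    fin_cases i
    · exact hac
    · exact hbd
    · exact hac.symm
    · exact hbd.symm
  have hbad : ∀ i, ¬ G.IsStrongColorableAt L (v i) := by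
    intro i
    fin_cases i <;> assumption
  refine exists_isCubicCycle hG hL (by norm_num) (v := v) (fun i j hij => ?_) hadj
    (fun i j hij => ?_) hbad
  · rcases h4 i j with h | rfl | rfl | rfl
    · exact h
    · exact absurd hij (hadj i).ne
    · exact absurd hij.symm (hadj j).ne
    · exact absurd hij (hopp i)
  · rcases h4 i j with rfl | h | h | rfl
    · exact absurd rfl hij.ne
    · exact Or.inl h
    · exact Or.inr h
    · have h1 := hadj (i + 1)
      rw [show i + 1 + 1 = i + 2 by ring] at h1
      exact absurd hij (not_adj_of_adj_of_adj hG hL (hbad i) (hadj i) h1)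

/-- An uncolourable component has no domino. -/
theorem not_domino (hG : ∀ v, (G.nbrs v).card ≤ 3) (hL : ∀ e ∈ G.edgeSet, 10 ≤ (L e).card)
    {v₁ v₂ v₃ v₄ w₁ w₂ : V} (hb : ¬ G.IsStrongColorableAt L v₁)
    (h12 : G.Adj v₁ v₂) (h23 : G.Adj v₂ v₃) (h34 : G.Adj v₃ v₄) (h41 : G.Adj v₄ v₁)
    (h1 : G.Adj v₁ w₁) (h2 : G.Adj v₂ w₂) (hw : G.Adj w₁ w₂)
    (hnd : [v₁, v₂, v₃, v₄, w₁, w₂].Nodup) : False := by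
  have b2 := not_isStrongColorableAt_of_adj hb h12
  have b3 := not_isStrongColorableAt_of_adj b2 h23
  have b4 := not_isStrongColorableAt_of_adj hb h41.symm
  have c1 := not_isStrongColorableAt_of_adj hb h1
  have c2 := not_isStrongColorableAt_of_adj b2 h2
  have hnd' := hnd
  simp only [List.nodup_cons, List.mem_cons, List.not_mem_nil, or_false, not_or, not_false_eq_true,
    List.nodup_nil, and_true] at hnd'
  obtain ⟨⟨n12, n13, n14, n15, n16⟩, ⟨n23, n24, n25, n26⟩, ⟨n34, n35, n36⟩, ⟨n45, n46⟩, n56⟩ := hnd'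
  have key : ∀ {a b c d : V}, ¬ G.IsStrongColorableAt L a → G.Adj a b → G.Adj a c → G.Adj a d →
      b ≠ c → b ≠ d → c ≠ d → G.HasNbrs a b c d := by
    intro a b c d ha hab hac had hbc hbd hcd
    obtain ⟨x, hx⟩ := exists_hasNbrs (card_nbrs_eq_three hG hL ha) hab hac hbc
    rcases (hx.adj_iff d).1 had with rfl | rfl | rfl
    · exact absurd rfl hbd
    · exact absurd rfl hcd
    · exact hx
  obtain ⟨y₃, hy3⟩ := exists_hasNbrs (card_nbrs_eq_three hG hL b3) h23.symm h34 n24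
  obtain ⟨y₄, hy4⟩ := exists_hasNbrs (card_nbrs_eq_three hG hL b4) h34.symm h41 (Ne.symm n13)
  obtain ⟨z₁, hz1⟩ := exists_hasNbrs (card_nbrs_eq_three hG hL c1) h1.symm hw n16
  obtain ⟨z₂, hz2⟩ := exists_hasNbrs (card_nbrs_eq_three hG hL c2) h2.symm hw.symm n25
  have hdom : G.IsDomino v₁ v₂ v₃ v₄ w₁ w₂ y₃ y₄ z₁ z₂ :=
    ⟨hnd, key hb h12 h41.symm h1 n24 n25 n45, key b2 h12.symm h23 h2 n13 n16 n36, hy3, hy4, hz1,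
      hz2⟩
  exact hb (hdom.isStrongColorableAt hG hL (not_adj_of_adj_of_adj hG hL b4 h41 h1)
    (not_adj_of_adj_of_adj hG hL b3 h23.symm h2))

/-- In an uncolourable component, the outer neighbours of two vertices of one side of a `K_{2,3}`
are distinct and adjacent. -/
theorem adj_of_bipartite (hG : ∀ v, (G.nbrs v).card ≤ 3) (hL : ∀ e ∈ G.edgeSet, 10 ≤ (L e).card)
    {a b c d p x y : V} (ha : ¬ G.IsStrongColorableAt L a) (hab : G.Adj a b) (had : G.Adj a d)
    (hap : G.Adj a p) (hcb : G.Adj c b) (hcd : G.Adj c d) (hcp : G.Adj c p) (hac : a ≠ c)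
    (hbd : b ≠ d) (hbp : b ≠ p) (hdp : d ≠ p) (hx : G.HasNbrs b a c x) (hy : G.HasNbrs d a c y) :
    G.Adj x y := by
  have hbx : G.Adj b x := (hx.adj_iff _).2 (by simp)
  have hdy : G.Adj d y := (hy.adj_iff _).2 (by simp)
  by_contra hxy
  by_cases hxy' : x = y
  · subst hxy'
    refine not_domino hG hL ha hab hcb.symm hcp hap.symm had hbx hdy ?_
    have hpx : p ≠ x := by
      rintro rfl
      exact not_adj_of_adj_of_adj hG hL ha hab hbx hap
    have := hab.ne
    have := had.ne
    have := hap.ne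
    have := hcb.ne
    have := hcd.ne
    have := hcp.ne
    have := hbx.ne
    have := hdy.ne
    have := hx.ne₂
    have := hx.ne₃
    simp only [List.nodup_cons, List.mem_cons, List.not_mem_nil, or_false, not_or,
      not_false_eq_true, List.nodup_nil, and_true]
    tauto
  · obtain ⟨w, hw⟩ := exists_isCubicCycle_four hG hL ha hab hcb.symm hcd had.symm hac hbd
    have h0 : w 0 = p := by
      rcases (hw.adj_iff 0 p).1 hap with h | h | h
      · exact absurd h.symm hdp
      · exact absurd h.symm hbp
      · exact h.symm
    have h2 : w 2 = p := by
      rcases (hw.adj_iff 2 p).1 hcp with h | h | h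
      · exact absurd h.symm hbp
      · exact absurd h.symm hdp
      · exact h.symm
    have h1 : w 1 = x := by
      rcases (hw.adj_iff 1 x).1 hbx with h | h | h
      · exact absurd h.symm hx.ne₂
      · exact absurd h.symm hx.ne₃
      · exact h.symm
    have h3 : w 3 = y := by
      rcases (hw.adj_iff 3 y).1 hdy with h | h | h
      · exact absurd h.symm hy.ne₃
      · exact absurd h.symm hy.ne₂
      · exact h.symm
    exact ha (hw.isStrongColorableAt_bipartite hG hL (h0.trans h2.symm) (by rwa [h1, h3])
      (by rwa [h1, h3]))

/-- An uncolourable component has no `K_{2,3}`. -/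
theorem not_bipartite (hG : ∀ v, (G.nbrs v).card ≤ 3) (hL : ∀ e ∈ G.edgeSet, 10 ≤ (L e).card)
    {a b c d p : V} (ha : ¬ G.IsStrongColorableAt L a) (hab : G.Adj a b) (had : G.Adj a d)
    (hap : G.Adj a p) (hcb : G.Adj c b) (hcd : G.Adj c d) (hcp : G.Adj c p) (hac : a ≠ c)
    (hbd : b ≠ d) (hbp : b ≠ p) (hdp : d ≠ p) : False := by
  have key : ∀ {z}, G.Adj a z → G.Adj c z → ∃ x, G.HasNbrs z a c x := fun haz hcz =>
    exists_hasNbrs (card_nbrs_eq_three hG hL (not_isStrongColorableAt_of_adj ha haz)) haz.symm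
      hcz.symm hac
  obtain ⟨x, hx⟩ := key hab hcb
  obtain ⟨y, hy⟩ := key had hcd
  obtain ⟨z, hz⟩ := key hap hcp
  have hxy := adj_of_bipartite hG hL ha hab had hap hcb hcd hcp hac hbd hbp hdp hx hy
  have hxz := adj_of_bipartite hG hL ha hab hap had hcb hcp hcd hac hbp hbd hdp.symm hx hz
  have hyz := adj_of_bipartite hG hL ha had hap hab hcd hcp hcb hac hdp hbd.symm hbp.symm hy hz
  have hbx := not_isStrongColorableAt_of_adj (not_isStrongColorableAt_of_adj ha hab)
    ((hx.adj_iff x).2 (by simp))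
  exact not_adj_of_adj_of_adj hG hL hbx hxy hyz hxz

/-- In an uncolourable component, opposite outer neighbours of a 4-cycle are distinct and not
adjacent. -/
theorem IsCubicCycle.not_adj_opposite {v w : ZMod 4 → V} (h : G.IsCubicCycle 4 v w)
    (hG : ∀ v, (G.nbrs v).card ≤ 3) (hL : ∀ e ∈ G.edgeSet, 10 ≤ (L e).card)
    (hb : ¬ G.IsStrongColorableAt L (v 0)) : w 0 ≠ w 2 ∧ ¬ G.Adj (w 0) (w 2) := by
  have a01 : G.Adj (v 0) (v 1) := h.adj_succ 0
  have a12 : G.Adj (v 1) (v 2) := h.adj_succ 1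
  have a23 : G.Adj (v 2) (v 3) := h.adj_succ 2
  have a30 : G.Adj (v 3) (v 0) := h.adj_succ 3
  have n02 : v 0 ≠ v 2 := h.injective.ne (by decide)
  have n13 : v 1 ≠ v 3 := h.injective.ne (by decide)
  have hne : w 0 ≠ w 2 := fun h02 =>
    not_bipartite hG hL hb a01 a30.symm (h.adj_w 0) a12.symm a23 (by rw [h02]; exact h.adj_w 2) n02
      n13 (h.ne 0 1).symm (h.ne 0 3).symm
  refine ⟨hne, fun hadj => ?_⟩
  have b1 := not_isStrongColorableAt_of_adj hb a01
  have b2 := not_isStrongColorableAt_of_adj b1 a12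
  have b3 := not_isStrongColorableAt_of_adj hb a30.symm
  have b0' := not_isStrongColorableAt_of_adj hb (h.adj_w 0)
  have b2' := not_isStrongColorableAt_of_adj b2 (h.adj_w 2)
  have hw : ∀ i j, w i ≠ v j := h.ne
  have hw' : ∀ i j, v j ≠ w i := fun i j => (h.ne i j).symm
  -- Two outer neighbours that are adjacent at consecutive vertices give a domino.
  have dom : ∀ i, ¬ G.IsStrongColorableAt L (v i) → ¬ G.Adj (w i) (w (i + 1)) := by
    intro i hi hi'
    have h1 := h.adj_succ (i + 1)
    have h2 := h.adj_succ (i + 2)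
    have h3 := h.adj_succ (i + 3)
    have h4 : ∀ i : ZMod 4, i + 1 + 1 = i + 2 ∧ i + 2 + 1 = i + 3 ∧ i + 3 + 1 = i ∧ i ≠ i + 1 ∧
      i ≠ i + 2 ∧ i ≠ i + 3 ∧ i + 1 ≠ i + 2 ∧ i + 1 ≠ i + 3 ∧ i + 2 ≠ i + 3 := by decide
    obtain ⟨e1, e2, e3, e⟩ := h4 i
    rw [e1] at h1
    rw [e2] at h2
    rw [e3] at h3
    refine not_domino hG hL hi (h.adj_succ i) h1 h2 h3 (h.adj_w i) (h.adj_w _) hi' ?_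
    have := hi'.ne
    simp only [List.nodup_cons, List.mem_cons, List.not_mem_nil, or_false, not_or,
      not_false_eq_true, List.nodup_nil, and_true, h.injective.eq_iff, hw']
    tauto
  -- If `w 0` and `w 2` are adjacent, the pentagon through them shares the outer neighbour `v 3`.
  set u : ZMod 5 → V := (![v 0, v 1, v 2, w 2, w 0] : Fin 5 → V) with hu
  have hadju : ∀ i, G.Adj (u i) (u (i + 1)) := by
    intro i
    fin_cases i
    · exact a01
    · exact a12
    · exact h.adj_w 2
    · exact hadj.symm
    · exact (h.adj_w 0).symm
  have hopp : ∀ i, u i ≠ u (i + 2) := by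
    intro i
    fin_cases i
    · exact n02
    · exact hw' 2 1
    · exact hw' 0 2
    · exact hw 2 0
    · exact hw 0 1
  have hbad : ∀ i, ¬ G.IsStrongColorableAt L (u i) := by
    intro i
    fin_cases i <;> assumption
  have hchord : ∀ i, ¬ G.Adj (u i) (u (i + 2)) := fun i => by
    have h1 := hadju (i + 1)
    rw [show i + 1 + 1 = i + 2 by ring] at h1
    exact not_adj_of_adj_of_adj hG hL (hbad i) (hadju i) h1
  have h5 : ∀ i j : ZMod 5, i = j ∨ j = i + 1 ∨ i = j + 1 ∨ j = i + 2 ∨ i = j + 2 := by decide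
  obtain ⟨x, hx⟩ := exists_isCubicCycle hG hL (by norm_num) (v := u) (fun i j hij => by
      rcases h5 i j with h | rfl | rfl | rfl | rfl
      · exact h
      · exact absurd hij (hadju i).ne
      · exact absurd hij.symm (hadju j).ne
      · exact absurd hij (hopp i)
      · exact absurd hij.symm (hopp j)) hadju (fun i j hij => by
      rcases h5 i j with rfl | h | h | rfl | rfl
      · exact absurd rfl hij.ne
      · exact Or.inl h
      · exact Or.inr h
      · exact absurd hij (hchord i)
      · exact absurd hij.symm (hchord j)) hbad
  have x0 : x 0 = v 3 := by
    rcases (hx.adj_iff 0 (v 3)).1 a30.symm with h' | h' | h'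
    · exact absurd h' (hw' 0 3)
    · exact absurd h'.symm n13
    · exact h'.symm
  have x1 : x 1 = w 1 := by
    rcases (hx.adj_iff 1 (w 1)).1 (h.adj_w 1) with h' | h' | h'
    · exact absurd h' (hw _ _)
    · exact absurd h' (hw _ _)
    · exact h'.symm
  have x2 : x 2 = v 3 := by
    rcases (hx.adj_iff 2 (v 3)).1 a23 with h' | h' | h'
    · exact absurd h'.symm n13
    · exact absurd h' (hw' 2 3)
    · exact h'.symm
  have a3 : G.Adj (w 2) (x 3) := hx.adj_w 3
  have a4 : G.Adj (w 0) (x 4) := hx.adj_w 4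
  have n3 : x 3 ≠ v 3 := fun h' => not_adj_of_adj_of_adj hG hL b2 (h.adj_w 2) (h' ▸ a3) a23
  have n4 : x 4 ≠ v 3 := fun h' => not_adj_of_adj_of_adj hG hL hb (h.adj_w 0) (h' ▸ a4) a30.symm
  refine hb (hx.isStrongColorableAt_squarePentagon hG hL (x0.trans x2.symm) ?_ ?_ ?_ ?_ ?_ ?_ ?_)
  · intro h'
    rw [x1] at h'
    exact dom 1 b1 (by rw [h']; exact a3.symm)
  · intro h'
    rw [x1] at h'
    exact dom 0 hb (by rw [zero_add, h']; exact a4)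
  · rw [x0]
    exact n3.symm
  · rw [x0]
    exact n4.symm
  · intro h'
    exact not_adj_of_adj_of_adj hG hL b0' hadj a3 (h'.symm ▸ a4)
  · rw [x0]
    intro h'
    rcases (h.adj_iff 3 _).1 h' with h' | h' | h'
    · exact hx.ne 3 2 h'
    · exact hx.ne 3 0 h'
    · exact dom 2 b2 (by rw [show (2 + 1 : ZMod 4) = 3 by decide, ← h']; exact a3)
  · rw [x0]
    intro h'
    rcases (h.adj_iff 3 _).1 h' with h' | h' | h'
    · exact hx.ne 4 2 h'
    · exact hx.ne 4 0 h'
    · exact dom 3 b3 (by rw [show (3 + 1 : ZMod 4) = 0 by decide, ← h']; exact a4.symm)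

/-- An uncolourable component has no 4-cycle. -/
theorem IsCubicCycle.false_of_four {v w : ZMod 4 → V} (h : G.IsCubicCycle 4 v w)
    (hG : ∀ v, (G.nbrs v).card ≤ 3) (hL : ∀ e ∈ G.edgeSet, 10 ≤ (L e).card)
    (hb : ∀ i, ¬ G.IsStrongColorableAt L (v i)) : False := by
  refine hb 0 (h.isStrongColorableAt_square hG hL fun i => ?_)
  have := (h.rotate i).not_adj_opposite hG hL (hb (0 + i))
  rwa [zero_add, add_comm 2 i] at this

end SimpleGraph

namespace SimpleGraph

variable {V : Type u} {G : SimpleGraph V}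

/-! ### Shortest cycles -/

/-- The vertices `f 0, …, f (m - 1)` form a cycle of length `m`. -/
structure IsCycleSeq (G : SimpleGraph V) (m : ℕ) (f : ℕ → V) : Prop where
  three_le : 3 ≤ m
  inj : ∀ a < m, ∀ b < m, f a = f b → a = b
  adj_succ : ∀ a, a + 1 < m → G.Adj (f a) (f (a + 1))
  adj_last : G.Adj (f (m - 1)) (f 0)

theorem IsCycleSeq.injective_zmod {m : ℕ} {f : ℕ → V} (h : G.IsCycleSeq m f) :
    Function.Injective fun i : ZMod m => f i.val := by
  have : NeZero m := ⟨by have := h.three_le; omega⟩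
  intro i j hij
  exact ZMod.val_injective m (h.inj _ (ZMod.val_lt i) _ (ZMod.val_lt j) hij)

theorem IsCycleSeq.adj_zmod {m : ℕ} {f : ℕ → V} (h : G.IsCycleSeq m f) (i : ZMod m) :
    G.Adj (f i.val) (f (i + 1).val) := by
  have h3 := h.three_le
  have : NeZero m := ⟨by omega⟩
  have h1 : (i + 1).val = (i.val + 1) % m := by
    rw [← ZMod.val_natCast, Nat.cast_add, ZMod.natCast_zmod_val, Nat.cast_one]
  have hi := ZMod.val_lt i
  by_cases hlt : i.val + 1 < m
  · rw [h1, Nat.mod_eq_of_lt hlt]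
    exact h.adj_succ _ hlt
  · have hm : i.val + 1 = m := by omega
    rw [h1, hm, Nat.mod_self]
    have := h.adj_last
    rwa [← hm, Nat.add_sub_cancel] at this

theorem zmod_add_natCast_inj {g : ℕ} {i : ZMod g} {a b d : ℕ} (hd : d < g) (ha : a ≤ d)
    (hb : b ≤ d) (h : i + (a : ZMod g) = i + b) : a = b := by
  have h1 := add_left_cancel h
  rw [ZMod.natCast_eq_natCast_iff', Nat.mod_eq_of_lt (by omega), Nat.mod_eq_of_lt (by omega)] at h1
  exact h1

/-- An arc of a cycle together with a path of `k ≥ 1` vertices outside the cycle. -/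
theorem isCycleSeq_ear {g : ℕ} {v : ZMod g → V} (hv : Function.Injective v)
    (hadj : ∀ i, G.Adj (v i) (v (i + 1))) (i : ZMod g) {d k : ℕ} (hd : 1 ≤ d) (hdg : d < g)
    (hk : 1 ≤ k) (x : ℕ → V) (hx : ∀ a < k, ∀ b < k, x a = x b → a = b)
    (hxv : ∀ a j, x a ≠ v j) (hxx : ∀ a, a + 1 < k → G.Adj (x a) (x (a + 1)))
    (h0 : G.Adj (v (i + d)) (x 0)) (h1 : G.Adj (x (k - 1)) (v i)) :
    G.IsCycleSeq (d + 1 + k) fun n => if n ≤ d then v (i + n) else x (n - (d + 1)) := by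
  refine ⟨by omega, fun a ha b hb hab => ?_, fun a ha => ?_, ?_⟩
  · by_cases h : a ≤ d <;> by_cases h' : b ≤ d <;> simp only [h, h', if_true, if_false] at hab
    · exact zmod_add_natCast_inj hdg h h' (hv hab)
    · exact absurd hab.symm (hxv _ _)
    · exact absurd hab (hxv _ _)
    · have := hx _ (by omega) _ (by omega) hab
      omega
  · by_cases h : a + 1 ≤ d
    · simp only [h, show a ≤ d by omega, if_true]
      have := hadj (i + a)
      rwa [add_assoc, ← Nat.cast_one, ← Nat.cast_add] at this
    · by_cases h' : a = d
      · subst h'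
        simpa using h0
      · simp only [h, show ¬ a ≤ d by omega, if_false]
        have := hxx (a - (d + 1)) (by omega)
        rwa [show a - (d + 1) + 1 = a + 1 - (d + 1) by omega] at this
  · simp only [show ¬ d + 1 + k - 1 ≤ d by omega, if_false, Nat.zero_le, if_true, Nat.cast_zero,
      add_zero, show d + 1 + k - 1 - (d + 1) = k - 1 by omega]
    exact h1

/-- An arc of a cycle together with a chord. -/
theorem isCycleSeq_chord {g : ℕ} {v : ZMod g → V} (hv : Function.Injective v)
    (hadj : ∀ i, G.Adj (v i) (v (i + 1))) (i : ZMod g) {d : ℕ} (hd : 2 ≤ d) (hdg : d < g)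
    (h1 : G.Adj (v (i + d)) (v i)) : G.IsCycleSeq (d + 1) fun n => v (i + n) := by
  refine ⟨by omega, fun a ha b hb hab => ?_, fun a ha => ?_, by simpa using h1⟩
  · exact zmod_add_natCast_inj hdg (by omega) (by omega) (hv hab)
  · have := hadj (i + a)
    rw [add_assoc, ← Nat.cast_one (R := ZMod g), ← Nat.cast_add] at this
    exact this

/-- An infinite walk in a finite graph that never turns back contains a cycle. -/
theorem exists_isCycleSeq [Finite V] {f : ℕ → V} (hf : ∀ n, G.Adj (f n) (f (n + 1)))
    (hf' : ∀ n, f n ≠ f (n + 2)) : ∃ m i, G.IsCycleSeq m fun n => f (i + n) := by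
  classical
  obtain ⟨i₀, j₀, hne, heq⟩ := Finite.exists_ne_map_eq_of_infinite f
  have hex : ∃ j, ∃ i < j, f i = f j := by
    rcases lt_or_gt_of_ne hne with h | h
    · exact ⟨j₀, i₀, h, heq⟩
    · exact ⟨i₀, j₀, h, heq.symm⟩
  obtain ⟨i, hij, hfij⟩ := Nat.find_spec hex
  have hmin : ∀ b, b < Nat.find hex → ∀ a < b, f a ≠ f b := fun b hb a ha hab =>
    Nat.find_min hex hb ⟨a, ha, hab⟩
  set j := Nat.find hex
  have h1 : j ≠ i + 1 := by
    intro h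
    rw [h] at hfij
    exact (hf i).ne hfij
  have h2 : j ≠ i + 2 := by
    intro h
    rw [h] at hfij
    exact hf' i hfij
  refine ⟨j - i, i, by omega, fun a ha b hb hab => ?_, fun a _ => hf (i + a), ?_⟩
  · by_contra hne
    rcases lt_or_gt_of_ne hne with h | h
    · exact hmin (i + b) (by omega) (i + a) (by omega) hab
    · exact hmin (i + a) (by omega) (i + b) (by omega) hab.symm
  · have := hf (j - 1)
    rw [show j - 1 + 1 = j by omega, ← hfij] at this
    rw [show i + (j - i - 1) = j - 1 by omega]
    exact this

section Component

variable [Fintype V] {C : Type w} [Nonempty C] {L : Sym2 V → Finset C}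

/-- An uncolourable component has minimum degree three, so it contains a cycle. -/
theorem exists_isCycleSeq_of_not_isStrongColorableAt (hG : ∀ v, (G.nbrs v).card ≤ 3)
    (hL : ∀ e ∈ G.edgeSet, 10 ≤ (L e).card) {r : V} (hr : ¬ G.IsStrongColorableAt L r) :
    ∃ m f, G.IsCycleSeq m f ∧ ¬ G.IsStrongColorableAt L (f 0) := by
  -- A walk that never turns back.
  have hstep : ∀ p : {p : V × V // G.Adj p.1 p.2 ∧ ¬ G.IsStrongColorableAt L p.1},
      ∃ q : {p : V × V // G.Adj p.1 p.2 ∧ ¬ G.IsStrongColorableAt L p.1},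
        q.1.1 = p.1.2 ∧ q.1.2 ≠ p.1.1 := by
    rintro ⟨⟨a, b⟩, hab, ha⟩
    have hb := not_isStrongColorableAt_of_adj ha hab
    obtain ⟨c, d, hc⟩ := exists_hasNbrs_of_adj (card_nbrs_eq_three hG hL hb) hab.symm
    exact ⟨⟨(b, c), (hc.adj_iff _).2 (by simp), hb⟩, rfl, hc.ne₁.symm⟩
  choose next hnext hnext' using hstep
  obtain ⟨x, hx⟩ : (G.nbrs r).Nonempty := by
    rw [← Finset.card_pos, card_nbrs_eq_three hG hL hr]
    norm_num
  set F : ℕ → {p : V × V // G.Adj p.1 p.2 ∧ ¬ G.IsStrongColorableAt L p.1} := fun n =>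
    next^[n] ⟨(r, x), mem_nbrs.1 hx, hr⟩ with hF
  have hFs : ∀ n, F (n + 1) = next (F n) := fun n => Function.iterate_succ_apply' _ _ _
  have hF2 : ∀ n, (F (n + 1)).1.1 = (F n).1.2 := fun n => by rw [hFs, hnext]
  obtain ⟨m, i, hm⟩ := exists_isCycleSeq (G := G) (f := fun n => (F n).1.1)
    (fun n => by
      rw [hF2]
      exact (F n).2.1)
    (fun n => by
      change (F n).1.1 ≠ (F (n + 1 + 1)).1.1
      rw [hF2, hFs]
      exact (hnext' (F n)).symm)
  exact ⟨m, _, hm, (F _).2.2⟩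

/-- Every component has a strong edge-colouring from lists of ten colours. Otherwise the arcs of a
shortest cycle of the component bound the distances at which its outer neighbours can coincide or be
adjacent. -/
theorem isStrongColorableAt (hG : ∀ v, (G.nbrs v).card ≤ 3)
    (hL : ∀ e ∈ G.edgeSet, 10 ≤ (L e).card) (r : V) : G.IsStrongColorableAt L r := by
  classical
  by_contra hr
  have hex : ∃ m, ∃ f, G.IsCycleSeq m f ∧ ¬ G.IsStrongColorableAt L (f 0) :=
    exists_isCycleSeq_of_not_isStrongColorableAt hG hL hr
  obtain ⟨f, hf, hf0⟩ := Nat.find_spec hex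
  have hmin : ∀ m f, G.IsCycleSeq m f → ¬ G.IsStrongColorableAt L (f 0) → Nat.find hex ≤ m :=
    fun m f h h' => Nat.find_min' hex ⟨f, h, h'⟩
  generalize Nat.find hex = g at hf hmin
  have hg := hf.three_le
  have : NeZero g := ⟨by omega⟩
  set v : ZMod g → V := fun i => f i.val with hvdef
  have hv : Function.Injective v := hf.injective_zmod
  have hadj : ∀ i, G.Adj (v i) (v (i + 1)) := hf.adj_zmod
  have hbad' : ∀ n : ℕ, ¬ G.IsStrongColorableAt L (v n) := by
    intro n
    induction n with
    | zero => simpa [hvdef] using hf0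
    | succ n ih =>
      rw [Nat.cast_succ]
      exact not_isStrongColorableAt_of_adj ih (hadj _)
  have hbad : ∀ i, ¬ G.IsStrongColorableAt L (v i) := fun i => by
    have := hbad' i.val
    rwa [ZMod.natCast_zmod_val] at this
  have hdiff : ∀ i j : ZMod g, j = i + ((j - i).val : ZMod g) := fun i j => by
    rw [ZMod.natCast_zmod_val]; ring
  have hneg : ∀ i j : ZMod g, i ≠ j → (j - i).val + (i - j).val = g := by
    intro i j hij
    have h2 : (i - j) = -(j - i) := by ring
    have h3 : NeZero (j - i) := ⟨sub_ne_zero.2 hij.symm⟩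
    have h4 := ZMod.val_lt (j - i)
    rw [h2, ZMod.val_neg_of_ne_zero]
    omega
  have hpos : ∀ i j : ZMod g, i ≠ j → 1 ≤ (j - i).val := by
    intro i j hij
    have := ZMod.val_lt (i - j)
    have := hneg i j hij
    omega
  have hchord : ∀ i j, G.Adj (v i) (v j) → j = i + 1 ∨ i = j + 1 := by
    intro i j hij
    have hne : i ≠ j := fun h => hij.ne (by rw [h])
    have h1 := hpos i j hne
    have h2 := hneg i j hne
    have h3 := hpos j i hne.symm
    by_contra hcon
    rw [not_or] at hcon
    have h4 : (j - i).val ≠ 1 := by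
      intro h
      refine hcon.1 ?_
      have := hdiff i j
      rwa [h, Nat.cast_one] at this
    have h5 : (i - j).val ≠ 1 := by
      intro h
      refine hcon.2 ?_
      have := hdiff j i
      rwa [h, Nat.cast_one] at this
    have h6 := hmin _ _ (isCycleSeq_chord hv hadj i (d := (j - i).val) (by omega) (by omega)
      (by rw [← hdiff]; exact hij.symm)) (hbad _)
    omega
  obtain ⟨w, hw⟩ := exists_isCubicCycle hG hL hg hv hadj hchord hbad
  have hg5 : 5 ≤ g := by
    by_contra hlt
    obtain rfl | rfl : g = 3 ∨ g = 4 := by omega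
    · exact hbad 0 (hw.isStrongColorableAt_triangle hG hL)
    · exact hw.false_of_four hG hL hbad
  -- A common outer neighbour, or an edge between outer neighbours, closes an arc to a cycle.
  have heq : ∀ i j, i ≠ j → w i = w j → g ≤ (j - i).val + 2 := by
    intro i j hij hwij
    have h1 := hpos i j hij
    have h2 := ZMod.val_lt (j - i)
    exact hmin _ _ (isCycleSeq_ear hv hadj i (d := (j - i).val) (k := 1) h1 h2 le_rfl
      (fun _ => w i) (fun a ha b hb _ => by omega) (fun _ _ => hw.ne _ _)
      (fun a ha => absurd ha (by omega)) (by rw [← hdiff, hwij]; exact hw.adj_w j)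
      (hw.adj_w i).symm) (by simpa using hbad _)
  have hwadj : ∀ i j, i ≠ j → G.Adj (w i) (w j) → g ≤ (j - i).val + 3 := by
    intro i j hij hwij
    have h1 := hpos i j hij
    have h2 := ZMod.val_lt (j - i)
    exact hmin _ _ (isCycleSeq_ear hv hadj i (d := (j - i).val) (k := 2) h1 h2 (by norm_num)
      (fun n => if n = 0 then w j else w i)
      (fun a ha b hb hab => by
        have := hwij.ne
        by_cases h : a = 0 <;> by_cases h' : b = 0 <;> simp only [h, h', if_true, if_false] at hab
        · omega
        · exact absurd hab.symm this
        · exact absurd hab this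
        · omega)
      (fun a _ => by split_ifs <;> exact hw.ne _ _)
      (fun a ha => by
        obtain rfl : a = 0 := by omega
        simpa using hwij.symm)
      (by rw [← hdiff]; simpa using hw.adj_w j)
      (by simpa using (hw.adj_w i).symm)) (by simpa using hbad _)
  refine hbad 0 (hw.isStrongColorableAt_of_injective hg5 hG hL (fun i j hij => ?_)
    fun i j hij => ?_)
  · by_contra hne
    have h1 := heq i j hne hij
    have h2 := heq j i (Ne.symm hne) hij.symm
    have h3 := hneg i j hne
    omega
  · have hne : i ≠ j := fun h => hij.ne (by rw [h])
    have h1 := hwadj i j hne hij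
    have h2 := hwadj j i hne.symm hij.symm
    have h3 := hneg i j hne
    by_cases h5 : g = 5
    · refine Or.inl ⟨h5, ?_⟩
      rcases (by omega : (j - i).val = 2 ∨ (i - j).val = 2) with h | h
      · have := hdiff i j
        rw [h] at this
        exact Or.inl (by exact_mod_cast this)
      · have := hdiff j i
        rw [h] at this
        exact Or.inr (by exact_mod_cast this)
    · refine Or.inr ⟨by omega, ?_⟩
      have := hdiff i j
      rw [show (j - i).val = 3 by omega] at this
      exact_mod_cast this

end Component

/-! ### Strong edge-colourings and normal edge-colourings -/

/-- A graph of maximum degree at most three has a strong edge-colouring from lists of ten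
colours. -/
theorem exists_strongEdgeColoring [Fintype V] {C : Type w} (hG : ∀ v, (G.nbrs v).card ≤ 3)
    (L : G.edgeSet → Finset C)
    (hL : ∀ e, 10 ≤ (L e).card) : ∃ φ : G.edgeSet → C, (∀ e, φ e ∈ L e) ∧
      ∀ e f : G.edgeSet, G.StrongAdj e f → φ e ≠ φ f := by
  classical
  rcases isEmpty_or_nonempty G.edgeSet with h | ⟨⟨e₀⟩⟩
  · exact ⟨fun e => (h.false e).elim, fun e => (h.false e).elim, fun e => (h.false e).elim⟩
  have : Nonempty C := by
    obtain ⟨c, -⟩ := Finset.card_pos.1 (lt_of_lt_of_le (by norm_num) (hL e₀))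
    exact ⟨c⟩
  set L' : Sym2 V → Finset C := fun e => if h : e ∈ G.edgeSet then L ⟨e, h⟩ else ∅ with hL'
  have hval : ∀ e : G.edgeSet, L' e = L e := fun e => by simp [hL']
  have key := fun r => isStrongColorableAt hG (L := L') (fun e he => by
    rw [show L' e = L ⟨e, he⟩ from hval ⟨e, he⟩]
    exact hL _) r
  choose Φ hΦ using key
  -- The colour of an edge is taken from the colouring for a representative of its component.
  set ρ : V → V := fun x => (G.connectedComponentMk x).out with hρ
  have hρr : ∀ x, G.Reachable (ρ x) x := fun x =>
    ConnectedComponent.exact (Quot.out_eq (G.connectedComponentMk x))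
  have hρe : ∀ {x y}, G.Reachable x y → ρ x = ρ y := fun h => by
    simp only [hρ, ConnectedComponent.sound h]
  have hend : ∀ e : G.edgeSet, ∀ x ∈ (e : Sym2 V), G.Reachable (e : Sym2 V).out.1 x := by
    rintro ⟨e, he⟩ x hx
    by_cases h : e.out.1 = x
    · dsimp only
      rw [h]
    · have h1 := (Sym2.mem_and_mem_iff h).1 ⟨e.out_fst_mem, hx⟩
      have h2 : G.Adj e.out.1 x := by
        rw [← mem_edgeSet, ← h1]
        exact he
      exact h2.reachable
  refine ⟨fun e => Φ (ρ (e : Sym2 V).out.1) e, fun e => ?_, fun e f hef => ?_⟩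
  · rw [← hval]
    exact (hΦ _ e e.2 ⟨_, (e : Sym2 V).out_fst_mem, hρr _⟩).1
  · obtain ⟨hne, x, hx, y, hy, hxy⟩ := hef
    have hxy' : G.Reachable x y := by
      rcases hxy with rfl | h
      · exact Reachable.refl _
      · exact h.reachable
    have h1 : ρ (e : Sym2 V).out.1 = ρ (f : Sym2 V).out.1 :=
      hρe (((hend e x hx).trans hxy').trans (hend f y hy).symm)
    dsimp only
    rw [h1]
    exact (hΦ _ e e.2 ⟨_, (e : Sym2 V).out_fst_mem, by rw [← h1]; exact hρr _⟩).2 f f.2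
      ⟨_, (f : Sym2 V).out_fst_mem, hρr _⟩ ⟨hne, x, hx, y, hy, hxy⟩

end SimpleGraph

theorem corollary1p6 {V : Type u} [Fintype V] (G : SimpleGraph V) [DecidableRel G.Adj]
    (hG : G.maxDegree ≤ 3) :
    SimpleGraph.listNormalChromaticIndex.{u, w} G ≤ 10 := by
  refine iInf₂_le_of_le 10 ?_ le_rfl
  intro C L hL
  obtain ⟨φ, hφ, hφ'⟩ := SimpleGraph.exists_strongEdgeColoring (G := G) (fun v => by
    refine le_trans ?_ ((G.degree_le_maxDegree v).trans hG)
    rw [← SimpleGraph.card_neighborFinset_eq_degree]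
    refine Finset.card_le_card fun x hx => ?_
    rw [SimpleGraph.mem_neighborFinset]
    exact SimpleGraph.mem_nbrs.1 hx) L hL
  have hadj : ∀ {e f : G.edgeSet}, f ∈ G.edgeNeighborhood e →
      e ≠ f ∧ ∃ x ∈ (e : Sym2 V), x ∈ (f : Sym2 V) := by
    intro e f hf
    exact SimpleGraph.lineGraph_adj_iff_exists.1 hf
  refine ⟨φ, ⟨fun e f hf => ?_, fun e => Or.inl fun f hf f' hf' hff => ?_⟩, hφ⟩
  · obtain ⟨hne, x, hx, hx'⟩ := hadj hf
    exact hφ' e f ⟨fun h => hne (Subtype.ext h), x, hx, x, hx', Or.inl rfl⟩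
  · -- Two edges adjacent to `e` are at distance at most one.
    by_contra hne
    obtain ⟨-, x, hx, hxf⟩ := hadj hf
    obtain ⟨-, y, hy, hyf⟩ := hadj hf'
    refine hφ' f f' ⟨fun h => hne (Subtype.ext h), x, hxf, y, hyf, ?_⟩ hff
    by_cases hxy : x = y
    · exact Or.inl hxy
    · refine Or.inr ?_
      rw [← SimpleGraph.mem_edgeSet, ← (Sym2.mem_and_mem_iff hxy).1 ⟨hx, hy⟩]
      exact e.2
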